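/- Let $A$ be a finite alphabet and $p\ge 2$. Let $\tau:A\to A^+$ be a substitution of constant length $p$ (that is, $|\tau(a)|=p$ for all $a\in A$), extended to words by concatenation. Assume that $\tau$ is one-to-one ($\tau(a)\neq\tau(b)$ for letters $a\neq b$) and primitive (there is $n\in\mathbb N$ such that $a$ appears in $\tau^n(b)$ for all $a,b\in A$). Let $X_\tau\subseteq A^{\mathbb Z}$ be the subshift generated by $\tau$, i.e. the set of all $x\in A^{\mathbb Z}$ each of whose finite sub-words is a sub-word of $\tau^m(a)$ for some $m\in\mathbb N$, $a\in A$, and assume that $X_\tau$ is infinite. Let $T$ be the shift, $(Tx)_i=x_{i+1}$, and let $\varrho$ be the metric on $A^{\mathbb Z}$ with $\varrho(x,y)=2^{-\min\{|i|\,:\,x_i\neq y_i\}}$ for $x\ne y$. A pair $(x,y)\in X_\tau\times X_\tau$ is a Li–Yorke pair if $\limsup_{n\to\infty}\varrho(T^nx,T^ny)>0$ and $\liminf_{n\to\infty}\varrho(T^nx,T^ny)=0$; its orbit is $\{(T^nx,T^ny):n\in\mathbb Z\}$. Then the set of orbits of Li–Yorke pairs of $X_\tau$ is either finite or uncountable.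 Moreover, the set of Li–Yorke pairs is uncountable if and only if there exist $m\in\mathbb N$, letters $a\neq b$ in $A$ and (possibly empty) words $u,v,w,u',v',w'$ with $|u|=|u'|$, $|v|=|v'|$, $|w|=|w'|$ such that $$\tau^m(a)=uavaw,\qquad \tau^m(b)=u'bv'bw',$$ and the words $vaw$ and $v'bw'$ have a coincidence, i.e. carry the same letter at some common coordinate. -/

import Mathlib

namespace Substitution

open Filter

/-- The substitution `τ : A → A⁺` extended to finite words by concatenation. -/
def onWord {A : Type*} (τ : A → List A) (w : List A) : List A := w.flatMap τ

/-- The word `τⁿ(a)`; in particular `τ⁰(a) = a`. -/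
def iter {A : Type*} (τ : A → List A) (n : ℕ) (a : A) : List A := (onWord τ)^[n] [a]

/-- Constant length `p`, with `p ≥ 2`. -/
def IsConstantLength {A : Type*} (τ : A → List A) (p : ℕ) : Prop :=
  2 ≤ p ∧ ∀ a, (τ a).length = p

/-- `τ` is primitive: for one `n`, every letter `a` appears in every word `τⁿ(b)`. -/
def IsPrimitive {A : Type*} (τ : A → List A) : Prop :=
  ∃ n : ℕ, ∀ a b : A, a ∈ iter τ n b

/-- The shift `T` on `A^ℤ`, `(T x)ᵢ = xᵢ₊₁`, as a bijection. -/
def shift {A : Type*} : Equiv.Perm (ℤ → A) where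
  toFun x := fun i => x (i + 1)
  invFun x := fun i => x (i - 1)
  left_inv x := by funext i; simp
  right_inv x := by funext i; simp

/-- The word `x_k x_{k+1} … x_{k+n-1}` of length `n`. -/
def word {A : Type*} (x : ℤ → A) (k : ℤ) (n : ℕ) : List A :=
  List.ofFn fun i : Fin n => x (k + (i : ℕ))

/-- The subshift `X_τ ⊆ A^ℤ`: the two-sided sequences all of whose finite sub-words are sub-words
of some `τᵐ(a)`. For a primitive substitution of constant length this is the smallest subshift in
which all the words `τᵐ(a)` appear; see `isLeast_subshift` below. -/
def subshift {A : Type*} (τ : A → List A) : Set (ℤ → A) :=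
  {x | ∀ (k : ℤ) (n : ℕ), ∃ (m : ℕ) (a : A), word x k n <:+: iter τ m a}

/-- The usual metric on `A^ℤ`: `2 ^ (-min {|i| : xᵢ ≠ yᵢ})` if `x ≠ y`, and `0` if `x = y`. -/
noncomputable def seqDist {A : Type*} (x y : ℤ → A) : ℝ :=
  open Classical in
  if x = y then 0 else (1 / 2 : ℝ) ^ sInf {n : ℕ | ∃ i : ℤ, i.natAbs = n ∧ x i ≠ y i}

/-- `(x, y)` is a Li–Yorke pair of `T` for the (bounded) metric `ϱ`. -/
def IsLiYorkePair {X : Type*} (ϱ : X → X → ℝ) (T : X → X) (x y : X) : Prop :=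
  0 < limsup (fun n : ℕ => ϱ (T^[n] x) (T^[n] y)) atTop ∧
    liminf (fun n : ℕ => ϱ (T^[n] x) (T^[n] y)) atTop = 0

/-- The set `LY(X_τ, T) ⊆ X_τ × X_τ` of Li–Yorke pairs. -/
def liYorkePairs {A : Type*} (τ : A → List A) : Set ((ℤ → A) × (ℤ → A)) :=
  {q | q.1 ∈ subshift τ ∧ q.2 ∈ subshift τ ∧ IsLiYorkePair seqDist shift q.1 q.2}

/-- The orbit of a pair under `T × T`. -/
def pairOrbit {A : Type*} (q : (ℤ → A) × (ℤ → A)) : Set ((ℤ → A) × (ℤ → A)) :=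
  {r | ∃ n : ℤ, r = ((shift ^ n) q.1, (shift ^ n) q.2)}

/-- Two words of the same length have a coincidence: some coordinate carries the same letter. -/
def HaveCoincidence {A : Type*} (u u' : List A) : Prop :=
  u.length = u'.length ∧ ∃ (i : ℕ) (c : A), u[i]? = some c ∧ u'[i]? = some c

/-- For some `m` and letters `a ≠ b`, `τᵐ(a) = u a v a w` and `τᵐ(b) = u' b v' b w'` with
`|u| = |u'|`, `|v| = |v'|`, `|w| = |w'|`, where `v a w` and `v' b w'` have a coincidence. The
words `u, v, w, u', v', w'` may be empty. -/
def CoincidenceCondition {A : Type*} (τ : A → List A) : Prop :=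
  ∃ (m : ℕ) (a b : A), a ≠ b ∧ ∃ u v w u' v' w' : List A,
    iter τ m a = u ++ [a] ++ v ++ [a] ++ w ∧
    iter τ m b = u' ++ [b] ++ v' ++ [b] ++ w' ∧
    u.length = u'.length ∧ v.length = v'.length ∧ w.length = w'.length ∧
    HaveCoincidence (v ++ [a] ++ w) (v' ++ [b] ++ w')

/-- A subshift: a shift-invariant subset of `A^ℤ`, closed for the product of the discrete
topologies. -/
def IsSubshift {A : Type*} (S : Set (ℤ → A)) : Prop :=
  @IsClosed (ℤ → A) (@Pi.topologicalSpace ℤ (fun _ => A) (fun _ => ⊥)) S ∧ shift '' S = S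

/-- The finite word `w` appears in `S`: it is a sub-word of a point of `S`. -/
def Appears {A : Type*} (w : List A) (S : Set (ℤ → A)) : Prop :=
  ∃ x ∈ S, ∃ k : ℤ, word x k w.length = w

theorem iterate_append {A : Type*} (τ : A → List A) (n : ℕ) (u v : List A) :
    (onWord τ)^[n] (u ++ v) = (onWord τ)^[n] u ++ (onWord τ)^[n] v := by
  induction n generalizing u v with
  | zero => rfl
  | succ n ih => simp only [Function.iterate_succ_apply]; rw [← ih]; simp [onWord]

theorem iterate_iter {A : Type*} (τ : A → List A) (m n : ℕ) (a : A) :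
    (onWord τ)^[m] (iter τ n a) = iter τ (m + n) a := by
  simp [iter, Function.iterate_add_apply]

theorem iter_infix {A : Type*} (τ : A → List A) {m n : ℕ} {a b : A} (h : b ∈ iter τ n a) :
    iter τ m b <:+: iter τ (m + n) a := by
  obtain ⟨s, t, hst⟩ := List.append_of_mem h
  refine ⟨(onWord τ)^[m] s, (onWord τ)^[m] t, ?_⟩
  rw [← iterate_iter, hst, List.append_cons, iterate_append, iterate_append]
  rfl

theorem length_iterate {A : Type*} {τ : A → List A} {p : ℕ} (hp : IsConstantLength τ p) (n : ℕ)
    (w : List A) : ((onWord τ)^[n] w).length = p ^ n * w.length := by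
  induction n generalizing w with
  | zero => simp
  | succ n ih =>
    rw [Function.iterate_succ_apply, ih]
    have : (onWord τ w).length = p * w.length := by
      simp [onWord, List.length_flatMap, hp.2, mul_comm]
    rw [this]; ring

/-- Every letter occurs strictly inside some iterate of itself. -/
theorem exists_interior {A : Type*} {τ : A → List A} {p : ℕ} (hp : IsConstantLength τ p)
    (hprim : IsPrimitive τ) (a : A) :
    ∃ (K : ℕ) (u v : List A), iter τ K a = u ++ [a] ++ v ∧ u ≠ [] ∧ v ≠ [] := by
  obtain ⟨N, hN⟩ := hprim
  have hl : (iter τ 2 a).length = p ^ 2 := by rw [iter, length_iterate hp]; simp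
  have h4 : 2 ^ 2 ≤ p ^ 2 := Nat.pow_le_pow_left hp.1 2
  obtain ⟨c, b, d, r, hcd⟩ : ∃ (c b d : A) (r : List A), iter τ 2 a = [c, b] ++ d :: r := by
    match h : iter τ 2 a with
    | [] | [_] | [_, _] => simp [h] at hl; omega
    | c :: b :: d :: r => exact ⟨c, b, d, r, by simp⟩
  obtain ⟨s, t, hst⟩ := List.append_of_mem (hN a b)
  have hne : ∀ w : List A, w ≠ [] → (onWord τ)^[N] w ≠ [] := by
    intro w hw h
    have h1 := length_iterate hp N w
    rw [h] at h1
    have h2 : 0 < p ^ N := Nat.pow_pos (by have := hp.1; omega)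
    have h3 := List.length_pos_iff.2 hw
    simp only [List.length_nil] at h1
    have := Nat.mul_pos h2 h3
    omega
  refine ⟨N + 2, (onWord τ)^[N] [c] ++ s, t ++ (onWord τ)^[N] (d :: r), ?_, ?_, ?_⟩
  · rw [← iterate_iter, hcd]
    have : [c, b] ++ d :: r = [c] ++ ([b] ++ d :: r) := rfl
    rw [this, iterate_append, iterate_append]
    have hb : (onWord τ)^[N] [b] = s ++ a :: t := hst
    rw [hb]; simp
  · have := hne [c] (by simp); simp [this]
  · have := hne (d :: r) (by simp); simp [this]

theorem appears_subshift {A : Type*} {τ : A → List A} {p : ℕ} (hp : IsConstantLength τ p)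
    (hprim : IsPrimitive τ) (n : ℕ) (a : A) : Appears (iter τ n a) (subshift τ) := by
  obtain ⟨K, u, v, hK, hu, hv⟩ := exists_interior hp hprim a
  obtain ⟨N, hN⟩ := hprim
  have hp1 : 1 ≤ p := by have := hp.1; omega
  -- nested words `W j`, each strictly inside the next
  set W : ℕ → List A := fun j => iter τ (K * j) a with hW
  set o : ℕ → ℕ := fun j => ∑ i ∈ Finset.range j, p ^ (K * i) * u.length with ho
  have hstep : ∀ j, W (j + 1) = (onWord τ)^[K * j] u ++ W j ++ (onWord τ)^[K * j] v := by
    intro j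
    have : W (j + 1) = (onWord τ)^[K * j] (iter τ K a) := by
      rw [iterate_iter]; simp [hW, mul_add]
    rw [this, hK, iterate_append, iterate_append]; rfl
  have hul : 1 ≤ u.length := List.length_pos_iff.2 hu
  have hvl : 1 ≤ v.length := List.length_pos_iff.2 hv
  have hpow : ∀ j, 1 ≤ p ^ (K * j) := fun j => Nat.one_le_pow _ _ hp1
  have hos : ∀ j, o (j + 1) = o j + p ^ (K * j) * u.length := fun j => by
    simp [ho, Finset.sum_range_succ]
  have hoj : ∀ j, j ≤ o j := by
    intro j
    induction j with
    | zero => simp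
    | succ j ih => rw [hos]; nlinarith [hpow j]
  have hlen : ∀ j, o j + j < (W j).length := by
    intro j
    induction j with
    | zero => simp [ho, hW, iter]
    | succ j ih =>
      rw [hstep, hos, List.length_append, List.length_append, length_iterate hp,
        length_iterate hp]
      nlinarith [hpow j]
  have hget1 : ∀ j i : ℕ, i < (W j).length → (W (j + 1))[i + (o (j + 1) - o j)]? = (W j)[i]? := by
    intro j i hi
    have e : i + (o (j + 1) - o j) = ((onWord τ)^[K * j] u).length + i := by
      rw [hos, length_iterate hp]; omega
    rw [hstep, e, List.append_assoc, List.getElem?_append_right (by omega),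
      List.getElem?_append_left (by omega)]
    congr 1; omega
  have hget : ∀ j d i : ℕ, i < (W j).length →
      (W (j + d))[i + (o (j + d) - o j)]? = (W j)[i]? ∧ o j ≤ o (j + d) := by
    intro j d i hi
    induction d with
    | zero => simp
    | succ d ih =>
      obtain ⟨ih, ih'⟩ := ih
      have hlt : i + (o (j + d) - o j) < (W (j + d)).length := by
        rw [List.getElem?_eq_getElem hi] at ih
        exact (List.getElem?_eq_some_iff.1 ih).1
      have h1 := hget1 (j + d) _ hlt
      have h2 := hos (j + d)
      refine ⟨?_, by rw [← add_assoc]; omega⟩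
      rw [← ih, ← h1, ← add_assoc]
      congr 1; omega
  let x : ℤ → A := fun i => ((W i.natAbs)[(i + o i.natAbs).toNat]?).getD a
  have hx : ∀ (j : ℕ) (i : ℤ), i.natAbs ≤ j → (W j)[(i + o j).toNat]? = some (x i) := by
    intro j i hij
    obtain ⟨d, rfl⟩ := Nat.exists_eq_add_of_le hij
    have h0 := hoj i.natAbs
    have h1 := hlen i.natAbs
    have h2 : (i + o i.natAbs).toNat < (W i.natAbs).length := by omega
    obtain ⟨h3, h4⟩ := hget i.natAbs d _ h2
    have h5 : (i + o (i.natAbs + d)).toNat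
        = (i + o i.natAbs).toNat + (o (i.natAbs + d) - o i.natAbs) := by omega
    rw [h5, h3]
    simp only [x]
    rw [List.getElem?_eq_getElem h2]; rfl
  have hword : ∀ (j : ℕ) (k : ℤ) (l : ℕ), (∀ i : ℕ, i < l → (k + i).natAbs ≤ j) → 0 ≤ k + o j →
      word x k l = ((W j).drop (k + o j).toNat).take l := by
    intro j k l h hk
    apply List.ext_getElem?
    intro i
    by_cases hi : i < l
    · have := hx j (k + i) (h i hi)
      have e : (k + i + o j).toNat = (k + o j).toNat + i := by omega
      rw [e] at this
      simp [word, hi, this, List.getElem?_drop]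
    · simp [word, hi]
  have hmem : x ∈ subshift τ := by
    intro k l
    refine ⟨K * (k.natAbs + l), a, ?_⟩
    have := hoj (k.natAbs + l)
    rw [hword (k.natAbs + l) k l (by intro i hi; omega) (by omega)]
    exact (List.take_prefix _ _).isInfix.trans (List.drop_suffix _ _).isInfix
  -- every `W j` occurs in `x`
  have hWx : ∀ j, ∃ k : ℤ, word x k (W j).length = W j := by
    intro j
    refine ⟨-(o j : ℤ), ?_⟩
    apply List.ext_getElem?
    intro i
    by_cases hi : i < (W j).length
    · set d := o j + i
      have h1 := (hget j d i hi).1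
      have h2 := (hget j d i hi).2
      have h3 := hx (j + d) (-(o j : ℤ) + i) (by omega)
      have e : (-(o j : ℤ) + i + o (j + d)).toNat = i + (o (j + d) - o j) := by omega
      rw [e, h1] at h3
      rw [h3]; simp [word, hi]
    · simp [word, hi]
  have hK1 : 1 ≤ K := by
    rcases Nat.eq_zero_or_pos K with rfl | h
    · have := congrArg List.length hK
      simp [iter] at this; omega
    · exact h
  obtain ⟨d, hd⟩ : ∃ d, K * (N + n) = n + N + d :=
    Nat.exists_eq_add_of_le (by nlinarith)
  have hne : iter τ d a ≠ [] := by
    apply List.ne_nil_of_length_pos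
    rw [iter, length_iterate hp]; simp; exact Nat.pow_pos (by omega)
  obtain ⟨b, hb⟩ := List.exists_mem_of_ne_nil _ hne
  have hin : iter τ n a <:+: W (N + n) := by
    have h1 : iter τ n a <:+: iter τ (n + N) b := iter_infix τ (hN a b)
    have h2 : iter τ (n + N) b <:+: iter τ (n + N + d) a := iter_infix τ hb
    simp only [hW]; rw [hd]; exact h1.trans h2
  obtain ⟨s, t, hst⟩ := hin
  obtain ⟨k, hk⟩ := hWx (N + n)
  refine ⟨x, hmem, k + s.length, ?_⟩
  apply List.ext_getElem?
  intro i
  by_cases hi : i < (iter τ n a).length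
  · have h1 := congrArg (fun l => l[s.length + i]?) hk
    have hl : s.length + i < (W (N + n)).length := by
      rw [← hst]; simp; omega
    simp only [word, List.getElem?_ofFn, hl, dite_true] at h1
    rw [← hst, List.append_assoc, List.getElem?_append_right (by omega),
      List.getElem?_append_left (by omega)] at h1
    simp only [Nat.add_sub_cancel_left] at h1
    rw [← h1]
    simp [word, hi, add_assoc]
  · simp [word, hi]

theorem shift_zpow_apply {A : Type*} (n : ℤ) (x : ℤ → A) (i : ℤ) :
    (shift ^ n) x i = x (i + n) := by
  induction n generalizing x i with
  | zero => simp
  | succ n ih => rw [zpow_add_one, Equiv.Perm.mul_apply, ih]; simp [shift, add_assoc]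
  | pred n ih =>
    rw [zpow_sub_one, Equiv.Perm.mul_apply, ih]
    simp only [Equiv.Perm.inv_def, shift, Equiv.coe_fn_symm_mk]
    congr 1; ring

theorem word_shift {A : Type*} (x : ℤ → A) (k n : ℤ) (l : ℕ) :
    word ((shift ^ n) x) k l = word x (k + n) l := by
  unfold word; congr 1; funext i; rw [shift_zpow_apply]; congr 1; ring

theorem shift_zpow_mem {A : Type*} {S : Set (ℤ → A)} (hS : shift '' S = S) (n : ℤ) {x : ℤ → A}
    (hx : x ∈ S) : (shift ^ n) x ∈ S := by
  induction n generalizing x with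
  | zero => simpa using hx
  | succ n ih =>
    rw [zpow_add_one, Equiv.Perm.mul_apply]
    exact ih (hS ▸ Set.mem_image_of_mem _ hx)
  | pred n ih =>
    rw [zpow_sub_one, Equiv.Perm.mul_apply]
    refine ih ?_
    rw [← hS] at hx
    obtain ⟨y, hy, rfl⟩ := hx
    simpa using hy

theorem isSubshift_subshift {A : Type*} (τ : A → List A) : IsSubshift (subshift τ) := by
  let _ : TopologicalSpace A := ⊥
  have : DiscreteTopology A := ⟨rfl⟩
  constructor
  · change IsClosed (subshift τ)
    have : subshift τ = ⋂ (k : ℤ) (n : ℕ), (fun x : ℤ → A => fun i : Fin n => x (k + (i : ℕ))) ⁻¹'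
        {f | ∃ (m : ℕ) (a : A), List.ofFn f <:+: iter τ m a} := by
      ext x; simp [subshift, word]
    rw [this]
    refine isClosed_iInter fun k => isClosed_iInter fun n => ?_
    exact (isClosed_discrete _).preimage (by fun_prop)
  · ext x
    constructor
    · rintro ⟨y, hy, rfl⟩ k n
      have := word_shift y k 1 n
      rw [zpow_one] at this
      rw [this]; exact hy _ _
    · intro hx
      refine ⟨(shift ^ (-1 : ℤ)) x, fun k n => ?_, by simp⟩
      rw [word_shift]; exact hx _ _

/-- For a primitive substitution of constant length, `X_τ` is the smallest subshift in which all
the words `τⁿ(a)` appear. -/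
theorem isLeast_subshift {A : Type*} {τ : A → List A} {p : ℕ} (hp : IsConstantLength τ p)
    (hprim : IsPrimitive τ) :
    IsLeast {S : Set (ℤ → A) | IsSubshift S ∧ ∀ (n : ℕ) (a : A), Appears (iter τ n a) S}
      (subshift τ) := by
  refine ⟨⟨isSubshift_subshift τ, appears_subshift hp hprim⟩, ?_⟩
  rintro S ⟨⟨hcl, hsh⟩, happ⟩ x hx
  let _ : TopologicalSpace A := ⊥
  have : DiscreteTopology A := ⟨rfl⟩
  have key : ∀ N : ℕ, ∃ y ∈ S, ∀ i : ℤ, i.natAbs ≤ N → y i = x i := by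
    intro N
    obtain ⟨m, a, s, t, hst⟩ := hx (-(N : ℤ)) (2 * N + 1)
    obtain ⟨y, hy, k, hk⟩ := happ m a
    refine ⟨(shift ^ (k + s.length + N)) y, shift_zpow_mem hsh _ hy, fun i hi => ?_⟩
    rw [shift_zpow_apply]
    have hlw : (word x (-(N : ℤ)) (2 * N + 1)).length = 2 * N + 1 := by simp [word]
    set j := (i + N).toNat with hj
    have hjN : j < 2 * N + 1 := by omega
    have hl : s.length + j < (iter τ m a).length := by
      rw [← hst]; simp [hlw]; omega
    have h1 := congrArg (fun l => l[s.length + j]?) hk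
    simp only [word, List.getElem?_ofFn, hl, dite_true] at h1
    rw [← hst, List.append_assoc, List.getElem?_append_right (by omega),
      List.getElem?_append_left (by omega)] at h1
    simp only [Nat.add_sub_cancel_left, word, List.getElem?_ofFn, hjN, dite_true,
      Option.some.injEq] at h1
    convert h1 using 2 <;> push_cast <;> omega
  choose y hyS hy using key
  refine IsClosed.mem_of_tendsto (f := y) (b := atTop) hcl ?_ (Eventually.of_forall hyS)
  rw [tendsto_pi_nhds]
  intro i
  apply tendsto_const_nhds.congr'
  filter_upwards [eventually_ge_atTop i.natAbs] with N hN using (hy N i hN).symm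

end Substitution

/-!
Write a pair of points of `X` as a sequence of pairs of letters, on which `τ × τ` acts. By
recognizability every point of `X` is `T ^ k (τ y)` for exactly one `k < p` and one `y ∈ X`, and the
two points of a Li–Yorke pair share the digit `k`, because they agree on arbitrarily long intervals.
So a Li–Yorke pair can be desubstituted forever, and is described by a sequence of digits and, at
each level, the pair of letters at the origin.

If `τᵐ(a, b)` with `a ≠ b` contains `(a, b)` at the positions `i < j` and a diagonal pair to the
right of `i`, every digit sequence in `{i, j}ᴺ` with infinitely many `i` is realized by a Li–Yorke
pair, and different digit sequences give different pairs.

Conversely, let two towers of Li–Yorke pairs have the same recurrent pair `q` at the origin, and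
infinitely often the same pair at the origin of the same level. A level at which their digits differ
yields, by way of the larger digit, an occurrence of `q` to the right of the origin and hence the
coincidence condition. If the condition fails, the digits therefore agree from some level on, and
the orbit is determined by finitely many possible windows around the origin.
-/

namespace Substitution

open Filter

variable {A : Type*} {τ : A → List A} {p : ℕ}

/-! ### Letters, inflation and words -/

/-- The letter at position `j` of the word `τⁿ(a)`, with junk value `a` beyond its length. -/
def letter (τ : A → List A) (n : ℕ) (a : A) (j : ℕ) : A := (iter τ n a).getD j a

/-- The action of `τⁿ`, of constant length `pⁿ`, on two-sided sequences: the word `τⁿ(xₜ)` occupies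
the coordinates from `pⁿ t` to `pⁿ (t + 1) - 1`. -/
def inflate (τ : A → List A) (p n : ℕ) (x : ℤ → A) : ℤ → A :=
  fun i => letter τ n (x (i / (p ^ n : ℕ))) (i % (p ^ n : ℕ)).toNat

theorem shift_zpow_shift_zpow (e f : ℤ) (x : ℤ → A) :
    (shift ^ e) ((shift ^ f) x) = (shift ^ (e + f)) x := by
  rw [zpow_add, Equiv.Perm.mul_apply]

theorem shift_zpow_neg_shift_zpow (e : ℤ) (x : ℤ → A) : (shift ^ (-e)) ((shift ^ e) x) = x := by
  rw [shift_zpow_shift_zpow, neg_add_cancel, zpow_zero, Equiv.Perm.coe_one, id]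

theorem IsConstantLength.pos (hp : IsConstantLength τ p) : 0 < p := zero_lt_two.trans_le hp.1

theorem IsConstantLength.pow_pos (hp : IsConstantLength τ p) (n : ℕ) : 0 < p ^ n :=
  Nat.pow_pos hp.pos

theorem iter_one (a : A) : iter τ 1 a = τ a := by simp [iter, onWord]

theorem length_iter (hp : IsConstantLength τ p) (n : ℕ) (a : A) :
    (iter τ n a).length = p ^ n := by
  rw [iter, length_iterate hp, List.length_singleton, mul_one]

theorem getElem?_iter (hp : IsConstantLength τ p) {n j : ℕ} (hj : j < p ^ n) (a : A) :
    (iter τ n a)[j]? = some (letter τ n a j) := by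
  have hj' : j < (iter τ n a).length := by rwa [length_iter hp]
  simp [letter, hj']

theorem letter_zero (a : A) : letter τ 0 a 0 = a := rfl

theorem mul_add_lt_mul {i j q r : ℕ} (hi : i < q) (hj : j < r) : i * r + j < q * r :=
  calc i * r + j < (i + 1) * r := by rw [add_one_mul]; omega
    _ ≤ q * r := Nat.mul_le_mul_right _ hi

theorem letter_add (hp : IsConstantLength τ p) {m n i j : ℕ} (hi : i < p ^ n) (hj : j < p ^ m)
    (a : A) : letter τ (m + n) a (i * p ^ m + j) = letter τ m (letter τ n a i) j := by
  obtain ⟨s, t, hst, hs⟩ : ∃ s t, iter τ n a = s ++ ([letter τ n a i] ++ t) ∧ s.length = i := by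
    have hi' : i < (iter τ n a).length := by rwa [length_iter hp]
    refine ⟨(iter τ n a).take i, (iter τ n a).drop (i + 1), ?_, by simp [hi'.le]⟩
    rw [← (List.getElem?_eq_some_iff.1 (getElem?_iter hp hi a)).2]
    simp
  have hlt : i * p ^ m + j < p ^ (m + n) := by
    rw [add_comm m, pow_add]; exact mul_add_lt_mul hi hj
  have hs' : ((onWord τ)^[m] s).length = i * p ^ m := by rw [length_iterate hp, hs, mul_comm]
  have hb : ((onWord τ)^[m] [letter τ n a i])[j]? = some (letter τ (m + n) a (i * p ^ m + j)) := by
    rw [← getElem?_iter hp hlt, ← iterate_iter, hst, iterate_append, iterate_append,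
      List.getElem?_append_right (by omega), hs', Nat.add_sub_cancel_left,
      List.getElem?_append_left (by rw [length_iterate hp]; simpa using hj)]
  exact Option.some.inj (hb.symm.trans (getElem?_iter hp hj _))

theorem eq_of_letter_eq (hp : IsConstantLength τ p) (hinj : Function.Injective τ) {n : ℕ}
    {a b : A} (h : ∀ j < p ^ n, letter τ n a j = letter τ n b j) : a = b := by
  induction n generalizing a b with
  | zero => exact h 0 (by simp)
  | succ n ih =>
    apply hinj
    rw [← iter_one (τ := τ) a, ← iter_one (τ := τ) b]
    refine List.ext_getElem? fun i => ?_
    by_cases hi : i < p ^ 1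
    · rw [getElem?_iter hp hi, getElem?_iter hp hi]
      refine congrArg some (ih fun j hj => ?_)
      rw [← letter_add hp hi hj, ← letter_add hp hi hj]
      refine h _ ?_
      rw [add_comm n, pow_add]
      exact mul_add_lt_mul hi hj
    · rw [List.getElem?_eq_none (by rw [length_iter hp]; omega),
        List.getElem?_eq_none (by rw [length_iter hp]; omega)]

theorem exists_eq_mul_add_of_pos {q : ℕ} (hq : 0 < q) (i : ℤ) :
    ∃ (t : ℤ) (j : ℕ), j < q ∧ i = q * t + j := by
  have hmod := Int.emod_nonneg i (b := q) (by omega)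
  refine ⟨i / q, (i % q).toNat, ?_, ?_⟩
  · have := Int.emod_lt_of_pos i (b := q) (by omega)
    omega
  · rw [Int.toNat_of_nonneg hmod, Int.mul_ediv_add_emod]

theorem inflate_mul_add (hp : IsConstantLength τ p) {n j : ℕ} (hj : j < p ^ n) (x : ℤ → A)
    (t : ℤ) : inflate τ p n x ((p ^ n : ℕ) * t + j) = letter τ n (x t) j := by
  have hdiv : (j : ℤ) / (p ^ n : ℕ) = 0 := Int.ediv_eq_zero_of_lt (by omega) (by exact_mod_cast hj)
  have hmod : (j : ℤ) % (p ^ n : ℕ) = j := Int.emod_eq_of_lt (by omega) (by exact_mod_cast hj)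
  rw [inflate, Int.mul_add_ediv_left _ _ (by exact_mod_cast (hp.pow_pos n).ne'),
    Int.mul_add_emod_self_left, hdiv, hmod, add_zero, Int.toNat_natCast]

theorem inflate_natCast (hp : IsConstantLength τ p) {n j : ℕ} (hj : j < p ^ n) (x : ℤ → A) :
    inflate τ p n x j = letter τ n (x 0) j := by
  simpa using inflate_mul_add hp hj x 0

theorem inflate_eq_iff (hp : IsConstantLength τ p) {n : ℕ} {x y : ℤ → A} :
    inflate τ p n x = y ↔
      ∀ (t : ℤ), ∀ j < p ^ n, letter τ n (x t) j = y ((p ^ n : ℕ) * t + j) := by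
  refine ⟨?_, fun h => funext fun i => ?_⟩
  · rintro rfl t j hj
    exact (inflate_mul_add hp hj x t).symm
  · obtain ⟨t, j, hj, rfl⟩ := exists_eq_mul_add_of_pos (hp.pow_pos n) i
    rw [inflate_mul_add hp hj, h t j hj]

theorem inflate_zero (hp : IsConstantLength τ p) (x : ℤ → A) : inflate τ p 0 x = x := by
  refine (inflate_eq_iff hp).2 fun t j hj => ?_
  obtain rfl : j = 0 := by simpa using hj
  simp [letter_zero]

theorem inflate_inflate (hp : IsConstantLength τ p) (m n : ℕ) (x : ℤ → A) :
    inflate τ p m (inflate τ p n x) = inflate τ p (m + n) x := by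
  refine ((inflate_eq_iff hp).2 fun t j hj => ?_).symm
  have hdiv : j / p ^ m < p ^ n := by
    rwa [Nat.div_lt_iff_lt_mul (hp.pow_pos m), ← pow_add, add_comm]
  have hmod := Nat.mod_lt j (hp.pow_pos m)
  have hj' : ((p ^ (m + n) : ℕ) : ℤ) * t + j
      = (p ^ m : ℕ) * ((p ^ n : ℕ) * t + (j / p ^ m : ℕ)) + (j % p ^ m : ℕ) := by
    conv_lhs => rw [← Nat.div_add_mod j (p ^ m)]
    push_cast
    ring
  rw [hj', inflate_mul_add hp hmod, inflate_mul_add hp hdiv, ← letter_add hp hdiv hmod, mul_comm,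
    Nat.div_add_mod]

theorem shift_zpow_inflate (hp : IsConstantLength τ p) (n : ℕ) (e : ℤ) (x : ℤ → A) :
    (shift ^ ((p ^ n : ℕ) * e)) (inflate τ p n x) = inflate τ p n ((shift ^ e) x) := by
  refine ((inflate_eq_iff hp).2 fun t j hj => ?_).symm
  rw [shift_zpow_apply, shift_zpow_apply, ← inflate_mul_add hp hj]
  congr 1
  ring

theorem inflate_injective (hp : IsConstantLength τ p) (hinj : Function.Injective τ) (n : ℕ) :
    Function.Injective (inflate τ p n) := by
  refine fun x y h => funext fun t => eq_of_letter_eq hp hinj (n := n) fun j hj => ?_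
  rw [← inflate_mul_add hp hj, ← inflate_mul_add hp hj, h]

theorem word_add (x : ℤ → A) (k : ℤ) (m n : ℕ) :
    word x k (m + n) = word x k m ++ word x (k + m) n := by
  simp only [word, List.ofFn_add, Fin.val_castLE, Fin.val_natAdd, Nat.cast_add, add_assoc]

theorem length_word (x : ℤ → A) (k : ℤ) (n : ℕ) : (word x k n).length = n := List.length_ofFn

theorem word_infix_word (x : ℤ → A) {k l : ℤ} {m n : ℕ} (hk : l ≤ k) (hn : k + m ≤ l + n) :
    word x k m <:+: word x l n := by
  obtain ⟨r, rfl⟩ := Int.le.dest hk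
  obtain ⟨s, rfl⟩ : ∃ s, n = r + m + s := Nat.exists_eq_add_of_le (by omega)
  exact ⟨word x l r, word x (l + (r + m : ℕ)) s, by rw [word_add, word_add]⟩

theorem Appears.subword {v w : List A} {S : Set (ℤ → A)} (h : Appears w S) (hv : v <:+: w) :
    Appears v S := by
  obtain ⟨x, hx, k, hk⟩ := h
  obtain ⟨s, t, rfl⟩ := hv
  refine ⟨x, hx, k + s.length, ?_⟩
  rw [List.length_append, List.length_append, word_add, word_add] at hk
  exact (List.append_inj' (List.append_inj hk (by simp [length_word])).1 (length_word ..)).2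

theorem word_inflate (hp : IsConstantLength τ p) (n : ℕ) (x : ℤ → A) (k : ℤ) :
    word (inflate τ p n x) ((p ^ n : ℕ) * k) (p ^ n) = iter τ n (x k) := by
  refine List.ext_getElem? fun j => ?_
  by_cases hj : j < p ^ n
  · rw [getElem?_iter hp hj, ← inflate_mul_add hp hj]
    simp [word, hj]
  · rw [List.getElem?_eq_none (by rw [length_word]; omega),
      List.getElem?_eq_none (by rw [length_iter hp]; omega)]

theorem word_inflate_mul (hp : IsConstantLength τ p) (n : ℕ) (x : ℤ → A) (k : ℤ) (l : ℕ) :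
    word (inflate τ p n x) ((p ^ n : ℕ) * k) (p ^ n * l) = (onWord τ)^[n] (word x k l) := by
  induction l with
  | zero =>
    exact (List.length_eq_zero_iff.1 (by rw [length_iterate hp, length_word, mul_zero])).symm
  | succ l ih =>
    have hlast : word x (k + l) 1 = [x (k + l)] := by simp [word]
    rw [mul_add, mul_one, word_add, word_add, iterate_append, ih, hlast, Nat.cast_mul, ← mul_add,
      word_inflate hp, iter]

theorem infix_iterate {u v : List A} (h : u <:+: v) (n : ℕ) :
    (onWord τ)^[n] u <:+: (onWord τ)^[n] v := by
  obtain ⟨s, t, rfl⟩ := h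
  exact ⟨(onWord τ)^[n] s, (onWord τ)^[n] t, by simp only [iterate_append]⟩

/-! ### The subshift under shift and inflation -/

theorem shift_zpow_mem_subshift {x : ℤ → A} (hx : x ∈ subshift τ) (e : ℤ) :
    (shift ^ e) x ∈ subshift τ :=
  shift_zpow_mem (isSubshift_subshift τ).2 e hx

theorem inflate_mem_subshift (hp : IsConstantLength τ p) {x : ℤ → A} (hx : x ∈ subshift τ)
    (n : ℕ) : inflate τ p n x ∈ subshift τ := by
  intro k l
  obtain ⟨t, j, hj, rfl⟩ := exists_eq_mul_add_of_pos (hp.pow_pos n) k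
  obtain ⟨m, a, hma⟩ := hx t (l + 1)
  refine ⟨n + m, a, ?_⟩
  rw [← iterate_iter]
  refine List.IsInfix.trans ?_ (infix_iterate hma n)
  rw [← word_inflate_mul hp]
  refine word_infix_word _ (by omega) ?_
  have hl : l ≤ p ^ n * l := Nat.le_mul_of_pos_left l (hp.pow_pos n)
  have hj' : j + l ≤ p ^ n * (l + 1) := by rw [mul_add_one]; omega
  linarith [(Nat.cast_le (α := ℤ)).2 hj', Nat.cast_add (R := ℤ) j l]

theorem subshift_nonempty [Nonempty A] (hp : IsConstantLength τ p) (hprim : IsPrimitive τ) :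
    (subshift τ).Nonempty := by
  obtain ⟨x, hx, -⟩ := appears_subshift hp hprim 0 (Classical.arbitrary A)
  exact ⟨x, hx⟩

theorem subshift_subset (hp : IsConstantLength τ p) (hprim : IsPrimitive τ) {S : Set (ℤ → A)}
    (hS : IsSubshift S) (h : ∀ n, ∃ x, inflate τ p n x ∈ S) : subshift τ ⊆ S := by
  refine (isLeast_subshift hp hprim).2 ⟨hS, fun n a => ?_⟩
  obtain ⟨N, hN⟩ := hprim
  obtain ⟨x, hx⟩ := h (n + N)
  have hx0 : Appears (iter τ (n + N) (x 0)) S :=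
    ⟨_, hx, (p ^ (n + N) : ℕ) * 0, by rw [length_iter hp, word_inflate hp]⟩
  exact hx0.subword (iter_infix τ (hN a (x 0)))

theorem continuous_shift_zpow [TopologicalSpace A] (e : ℤ) :
    Continuous (shift ^ e : Equiv.Perm (ℤ → A)) :=
  continuous_pi fun i => by simpa only [shift_zpow_apply] using continuous_apply (i + e)

section Topology

variable [TopologicalSpace A] [DiscreteTopology A]

theorem continuous_inflate (n : ℕ) : Continuous (inflate τ p n) :=
  continuous_pi fun i =>
    (continuous_of_discreteTopology (f := fun a => letter τ n a (i % (p ^ n : ℕ)).toNat)).comp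
      (continuous_apply (i / (p ^ n : ℕ)))

theorem isClosed_subshift : IsClosed (subshift τ) := by
  have h := (isSubshift_subshift τ).1
  rwa [← DiscreteTopology.eq_bot (α := A)] at h

theorem isCompact_subshift [Finite A] : IsCompact (subshift τ) := isClosed_subshift.isCompact

theorem isSubshift_of_isClosed {S : Set (ℤ → A)} (hS : IsClosed S)
    (h : ∀ e : ℤ, ∀ x ∈ S, (shift ^ e) x ∈ S) : IsSubshift S := by
  refine ⟨by rwa [← DiscreteTopology.eq_bot (α := A)], Set.Subset.antisymm ?_ fun x hx => ?_⟩
  · rintro _ ⟨x, hx, rfl⟩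
    exact h 1 x hx
  · exact ⟨_, h (-1) x hx, by simp⟩

end Topology

theorem exists_shift_zpow_inflate_eq (hp : IsConstantLength τ p) (n : ℕ) (e : ℤ) {x : ℤ → A}
    (hx : x ∈ subshift τ) : ∃ k < p ^ n, ∃ y ∈ subshift τ,
      (shift ^ e) (inflate τ p n x) = (shift ^ (k : ℤ)) (inflate τ p n y) := by
  obtain ⟨t, k, hk, rfl⟩ := exists_eq_mul_add_of_pos (hp.pow_pos n) e
  refine ⟨k, hk, (shift ^ t) x, shift_zpow_mem_subshift hx t, ?_⟩
  rw [← shift_zpow_inflate hp, shift_zpow_shift_zpow, add_comm]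

theorem exists_eq_shift_inflate [Finite A] (hp : IsConstantLength τ p) (hprim : IsPrimitive τ)
    (n : ℕ) {x : ℤ → A} (hx : x ∈ subshift τ) :
    ∃ k < p ^ n, ∃ y ∈ subshift τ, x = (shift ^ (k : ℤ)) (inflate τ p n y) := by
  let _ : TopologicalSpace A := ⊥
  have : DiscreteTopology A := ⟨rfl⟩
  let S : Set (ℤ → A) :=
    ⋃ k ∈ Set.Iio (p ^ n), (fun y => (shift ^ (k : ℤ)) (inflate τ p n y)) '' subshift τ
  have mem_S {z : ℤ → A} :
      z ∈ S ↔ ∃ k < p ^ n, ∃ y ∈ subshift τ, z = (shift ^ (k : ℤ)) (inflate τ p n y) := by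
    simp only [S, Set.mem_iUnion, Set.mem_Iio, Set.mem_image, exists_prop, eq_comm (a := z)]
  have hclosed : IsClosed S := (Set.finite_Iio _).isClosed_biUnion fun k _ =>
    (isCompact_subshift.image ((continuous_shift_zpow _).comp (continuous_inflate n))).isClosed
  have hshift : ∀ e : ℤ, ∀ z ∈ S, (shift ^ e) z ∈ S := by
    intro e z hz
    obtain ⟨k, -, y, hy, rfl⟩ := mem_S.1 hz
    rw [shift_zpow_shift_zpow]
    exact mem_S.2 (exists_shift_zpow_inflate_eq hp n _ hy)
  refine mem_S.1 (subshift_subset hp hprim (isSubshift_of_isClosed hclosed hshift) ?_ hx)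
  refine fun m => ⟨inflate τ p n x, mem_S.2 ⟨0, hp.pow_pos n, inflate τ p m x, ?_, ?_⟩⟩
  · exact inflate_mem_subshift hp hx m
  · simp only [inflate_inflate hp, add_comm, Nat.cast_zero, zpow_zero, Equiv.Perm.coe_one, id]

theorem shift_zpow_mem_image_inflate [Finite A] (hp : IsConstantLength τ p)
    (hprim : IsPrimitive τ) {n : ℕ} {e : ℤ} {x : ℤ → A} (hx : x ∈ subshift τ)
    (he : (shift ^ e) (inflate τ p n x) ∈ inflate τ p n '' subshift τ) {y : ℤ → A}
    (hy : y ∈ subshift τ) : (shift ^ e) (inflate τ p n y) ∈ inflate τ p n '' subshift τ := by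
  let _ : TopologicalSpace A := ⊥
  have : DiscreteTopology A := ⟨rfl⟩
  let S : Set (ℤ → A) := {z | (shift ^ e) (inflate τ p n z) ∈ inflate τ p n '' subshift τ}
  have hclosed : IsClosed S := (isCompact_subshift.image (continuous_inflate n)).isClosed.preimage
    ((continuous_shift_zpow e).comp (continuous_inflate n))
  have hshift : ∀ f : ℤ, ∀ z ∈ S, (shift ^ f) z ∈ S := by
    rintro f z ⟨w, hw, hzw⟩
    refine ⟨(shift ^ f) w, shift_zpow_mem_subshift hw f, ?_⟩
    rw [← shift_zpow_inflate hp, ← shift_zpow_inflate hp, hzw, shift_zpow_shift_zpow,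
      shift_zpow_shift_zpow, add_comm]
  refine subshift_subset hp hprim (isSubshift_of_isClosed hclosed hshift) (fun m => ?_) hy
  obtain ⟨k, -, w, -, rfl⟩ := exists_eq_shift_inflate hp hprim m hx
  refine ⟨w, ?_⟩
  have := hshift (-k) _ he
  rwa [shift_zpow_neg_shift_zpow] at this

/-! ### Recognizability -/

/-- The return times of `τⁿ(X)` to itself: the `e` with `Tᵉ τⁿ(X) = τⁿ(X)`. -/
def returnTimes (τ : A → List A) (p n : ℕ) : AddSubgroup ℤ where
  carrier := {e | (shift ^ e) '' (inflate τ p n '' subshift τ) = inflate τ p n '' subshift τ}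
  zero_mem' := by simp
  add_mem' := by
    intro e f he hf
    rw [Set.mem_ofPred_eq, zpow_add, Equiv.Perm.coe_mul, Set.image_comp, hf, he]
  neg_mem' := by
    intro e he
    rw [Set.mem_ofPred_eq, ← he, ← Set.image_comp, ← Equiv.Perm.coe_mul, ← zpow_add,
      neg_add_cancel, zpow_zero, Equiv.Perm.coe_one, Set.image_id, he]

theorem mem_returnTimes [Finite A] (hp : IsConstantLength τ p) (hprim : IsPrimitive τ) {n : ℕ}
    {e : ℤ} {x y : ℤ → A} (hx : x ∈ subshift τ) (hy : y ∈ subshift τ)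
    (hxy : (shift ^ e) (inflate τ p n x) = inflate τ p n y) : e ∈ returnTimes τ p n := by
  refine Set.Subset.antisymm ?_ ?_
  · rintro _ ⟨_, ⟨z, hz, rfl⟩, rfl⟩
    exact shift_zpow_mem_image_inflate hp hprim hx ⟨y, hy, hxy.symm⟩ hz
  · rintro _ ⟨z, hz, rfl⟩
    have hyx : (shift ^ (-e)) (inflate τ p n y) = inflate τ p n x := by
      rw [← hxy, shift_zpow_neg_shift_zpow]
    refine ⟨_, shift_zpow_mem_image_inflate hp hprim hy ⟨x, hx, hyx.symm⟩ hz, ?_⟩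
    simp

theorem exists_shift_inflate_eq_of_mem {n : ℕ} {e : ℤ} (he : e ∈ returnTimes τ p n) {x : ℤ → A}
    (hx : x ∈ subshift τ) :
    ∃ y ∈ subshift τ, (shift ^ e) (inflate τ p n x) = inflate τ p n y := by
  have he : (shift ^ e) '' (inflate τ p n '' subshift τ) = inflate τ p n '' subshift τ := he
  obtain ⟨y, hy, hxy⟩ := he ▸ Set.mem_image_of_mem _ (Set.mem_image_of_mem _ hx)
  exact ⟨y, hy, hxy.symm⟩

/-- The positive generator of the group of return times of `τⁿ(X)` to itself. -/
noncomputable def returnPeriod (τ : A → List A) (p n : ℕ) : ℕ := (returnTimes τ p n).index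

theorem mem_returnTimes_iff {n : ℕ} {e : ℤ} :
    e ∈ returnTimes τ p n ↔ (returnPeriod τ p n : ℤ) ∣ e := by
  obtain ⟨g, hg⟩ := Int.subgroup_cyclic (returnTimes τ p n)
  rw [← AddSubgroup.zmultiples_eq_closure] at hg
  rw [returnPeriod, hg, Int.index_zmultiples, Int.natAbs_dvd, Int.mem_zmultiples_iff]

theorem pow_mem_returnTimes [Finite A] [Nonempty A] (hp : IsConstantLength τ p)
    (hprim : IsPrimitive τ) (n : ℕ) : ((p ^ n : ℕ) : ℤ) ∈ returnTimes τ p n := by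
  obtain ⟨x, hx⟩ := subshift_nonempty hp hprim
  refine mem_returnTimes hp hprim hx (shift_zpow_mem_subshift hx 1) ?_
  rw [← shift_zpow_inflate hp, mul_one]

/-- The order of the root of the shift of `X` obtained by conjugating the return map of `τⁿ(X)` by
`τⁿ`; recognizability is the assertion that it is `1`. -/
noncomputable def rootDegree (τ : A → List A) (p n : ℕ) : ℕ := p ^ n / returnPeriod τ p n

theorem returnPeriod_mul_rootDegree [Finite A] [Nonempty A] (hp : IsConstantLength τ p)
    (hprim : IsPrimitive τ) (n : ℕ) : returnPeriod τ p n * rootDegree τ p n = p ^ n :=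
  Nat.mul_div_cancel' <| Int.natCast_dvd_natCast.1 <|
    mem_returnTimes_iff.1 (pow_mem_returnTimes hp hprim n)

theorem rootDegree_dvd_succ [Finite A] [Nonempty A] (hp : IsConstantLength τ p)
    (hprim : IsPrimitive τ) (n : ℕ) : rootDegree τ p n ∣ rootDegree τ p (n + 1) := by
  have hmem : ((p * returnPeriod τ p n : ℕ) : ℤ) ∈ returnTimes τ p (n + 1) := by
    obtain ⟨x, hx⟩ := subshift_nonempty hp hprim
    obtain ⟨y, hy, hxy⟩ := exists_shift_inflate_eq_of_mem (mem_returnTimes_iff.2 dvd_rfl) hx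
    refine mem_returnTimes hp hprim hx hy ?_
    rw [add_comm, ← inflate_inflate hp, ← inflate_inflate hp, ← hxy, ← shift_zpow_inflate hp,
      pow_one, Nat.cast_mul]
  obtain ⟨c, hc⟩ := Int.natCast_dvd_natCast.1 (mem_returnTimes_iff.1 hmem)
  have hn := returnPeriod_mul_rootDegree hp hprim n
  have hn1 := returnPeriod_mul_rootDegree hp hprim (n + 1)
  refine ⟨c, Nat.eq_of_mul_eq_mul_left
    (Nat.pos_of_mul_pos_right (hn1 ▸ hp.pow_pos (n + 1) : 0 < _ * rootDegree τ p (n + 1))) ?_⟩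
  rw [hn1, pow_succ, ← hn]
  linear_combination rootDegree τ p n * hc

/-- The sliding block code with local rule `f` on two consecutive letters. -/
def blockCode (f : A × A → A) (x : ℤ → A) : ℤ → A := fun t => f (x t, x (t + 1))

theorem inflate_natCast_congr (hp : IsConstantLength τ p) {n i : ℕ} {x y : ℤ → A}
    (h0 : x 0 = y 0) (h1 : x 1 = y 1) (hi : i < 2 * p ^ n) :
    inflate τ p n x i = inflate τ p n y i := by
  by_cases hi' : i < p ^ n
  · rw [inflate_natCast hp hi', inflate_natCast hp hi', h0]
  · obtain ⟨k, rfl⟩ := Nat.exists_eq_add_of_le (not_lt.1 hi')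
    have hk : k < p ^ n := by omega
    have h := fun z : ℤ → A => inflate_mul_add hp hk z 1
    rw [mul_one, ← Nat.cast_add] at h
    rw [h, h, h1]

theorem apply_zero_eq_of_shift_inflate_eq (hp : IsConstantLength τ p)
    (hinj : Function.Injective τ) {n e : ℕ} (he : e ≤ p ^ n) {x x' y y' : ℤ → A}
    (hxy : (shift ^ (e : ℤ)) (inflate τ p n x) = inflate τ p n y)
    (hxy' : (shift ^ (e : ℤ)) (inflate τ p n x') = inflate τ p n y')
    (h0 : x 0 = x' 0) (h1 : x 1 = x' 1) : y 0 = y' 0 := by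
  refine eq_of_letter_eq hp hinj (n := n) fun j hj => ?_
  rw [← inflate_natCast hp hj, ← inflate_natCast hp hj, ← hxy, ← hxy', shift_zpow_apply,
    shift_zpow_apply, ← Nat.cast_add]
  exact inflate_natCast_congr hp h0 h1 (by omega)

theorem exists_blockCode (hp : IsConstantLength τ p) (hinj : Function.Injective τ) {n e : ℕ}
    (he : e ≤ p ^ n) : ∃ f : A × A → A, ∀ x y : ℤ → A,
      (shift ^ (e : ℤ)) (inflate τ p n x) = inflate τ p n y → y = blockCode f x := by
  let Z := {z : (ℤ → A) × (ℤ → A) // (shift ^ (e : ℤ)) (inflate τ p n z.1) = inflate τ p n z.2}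
  have hfactor : (fun z : Z => z.1.2 0).FactorsThrough (fun z : Z => (z.1.1 0, z.1.1 1)) :=
    fun z w hzw => apply_zero_eq_of_shift_inflate_eq hp hinj he z.2 w.2 (Prod.ext_iff.1 hzw).1
      (Prod.ext_iff.1 hzw).2
  refine ⟨Function.extend (fun z : Z => (z.1.1 0, z.1.1 1)) (fun z : Z => z.1.2 0) Prod.fst,
    fun x y hxy => funext fun t => ?_⟩
  have hxyt : (shift ^ (e : ℤ)) (inflate τ p n ((shift ^ t) x)) =
      inflate τ p n ((shift ^ t) y) := by
    rw [← shift_zpow_inflate hp, ← shift_zpow_inflate hp, ← hxy, shift_zpow_shift_zpow,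
      shift_zpow_shift_zpow, add_comm]
  simpa [blockCode, shift_zpow_apply, add_comm] using
    (hfactor.extend_apply Prod.fst ⟨((shift ^ t) x, (shift ^ t) y), hxyt⟩).symm

theorem shift_zpow_inflate_eq_iterate {n : ℕ} {e : ℤ} (he : e ∈ returnTimes τ p n)
    {F : (ℤ → A) → ℤ → A}
    (hF : ∀ x y, (shift ^ e) (inflate τ p n x) = inflate τ p n y → y = F x) (k : ℕ)
    {x : ℤ → A} (hx : x ∈ subshift τ) :
    F^[k] x ∈ subshift τ ∧ (shift ^ (e * k)) (inflate τ p n x) = inflate τ p n (F^[k] x) := by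
  induction k with
  | zero => exact ⟨hx, by simp⟩
  | succ k ih =>
    obtain ⟨y, hy, hxy⟩ := exists_shift_inflate_eq_of_mem he ih.1
    rw [Function.iterate_succ_apply', ← hF _ _ hxy]
    refine ⟨hy, ?_⟩
    rw [← hxy, ← ih.2, shift_zpow_shift_zpow]
    congr 2
    push_cast
    ring

theorem exists_iterate_blockCode_eq_shift [Finite A] [Nonempty A] (hp : IsConstantLength τ p)
    (hprim : IsPrimitive τ) (hinj : Function.Injective τ) (n : ℕ) :
    ∃ f : A × A → A, ∀ x ∈ subshift τ, ∀ k : ℕ,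
      (blockCode f)^[rootDegree τ p n * k] x = (shift ^ (k : ℤ)) x := by
  have hn := returnPeriod_mul_rootDegree hp hprim n
  obtain ⟨f, hf⟩ := exists_blockCode hp hinj (n := n)
    (Nat.le_of_dvd (hp.pow_pos n) (Dvd.intro _ hn))
  refine ⟨f, fun x hx k => inflate_injective hp hinj n ?_⟩
  rw [← (shift_zpow_inflate_eq_iterate (mem_returnTimes_iff.2 dvd_rfl) hf _ hx).2,
    ← shift_zpow_inflate hp, ← Nat.cast_mul, ← mul_assoc, hn, Nat.cast_mul]

theorem eq_zero_of_forall_shift_zpow_eq [Finite A] (hinf : (subshift τ).Infinite) {e : ℤ}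
    (h : ∀ x ∈ subshift τ, (shift ^ e) x = x) : e = 0 := by
  by_contra he
  have hmod : ∀ x ∈ subshift τ, ∀ i, x i = x (i % e) := by
    intro x hx i
    have hper : Function.Periodic x e := fun j => by
      rw [← shift_zpow_apply e x, h x hx]
    rw [Int.emod_def, mul_comm]
    exact (hper.sub_int_mul_eq (i / e)).symm
  have hinjOn : (subshift τ).InjOn fun x (i : Set.Ico 0 |e|) => x i := by
    refine fun x hx y hy hxy => funext fun i => ?_
    rw [hmod x hx, hmod y hy]
    exact congrFun hxy ⟨i % e, Int.emod_nonneg i he, Int.emod_lt_abs i he⟩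
  exact hinf (Set.Finite.of_finite_image (Set.toFinite _) hinjOn)

theorem eq_of_iterate_eq_shift_zpow [Finite A] (hinf : (subshift τ).Infinite)
    {F : (ℤ → A) → ℤ → A} {q r : ℕ}
    (hq : ∀ x ∈ subshift τ, ∀ k : ℕ, F^[q * k] x = (shift ^ (k : ℤ)) x)
    (hr : ∀ x ∈ subshift τ, ∀ k : ℕ, F^[r * k] x = (shift ^ (k : ℤ)) x) : q = r := by
  have h : (q - r : ℤ) = 0 := eq_zero_of_forall_shift_zpow_eq hinf fun x hx => by
    have hrq : (shift ^ (r : ℤ)) x = (shift ^ (q : ℤ)) x := by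
      rw [← hq x hx, ← hr x hx, mul_comm]
    rw [sub_eq_neg_add, ← shift_zpow_shift_zpow, ← hrq, shift_zpow_neg_shift_zpow]
  omega

theorem monotone_rootDegree [Finite A] [Nonempty A] (hp : IsConstantLength τ p)
    (hprim : IsPrimitive τ) : Monotone (rootDegree τ p) :=
  monotone_nat_of_le_succ fun n => Nat.le_of_dvd
    (Nat.pos_of_mul_pos_left ((returnPeriod_mul_rootDegree hp hprim (n + 1)).symm ▸ hp.pow_pos _))
    (rootDegree_dvd_succ hp hprim n)

/- The roots of the shift given by the levels `n` are all block codes on two letters. There are only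
finitely many such codes, and a code determines the degree of the root. -/
theorem exists_rootDegree_succ_eq [Finite A] [Nonempty A] (hp : IsConstantLength τ p)
    (hprim : IsPrimitive τ) (hinj : Function.Injective τ) (hinf : (subshift τ).Infinite) (n : ℕ) :
    ∃ m ≥ n, rootDegree τ p (m + 1) = rootDegree τ p m := by
  choose f hf using exists_iterate_blockCode_eq_shift hp hprim hinj
  obtain ⟨k, l, hkl, hfkl⟩ : ∃ k l, k < l ∧ f (n + k) = f (n + l) := by
    obtain ⟨k, l, hne, h⟩ := Finite.exists_ne_map_eq_of_infinite fun k => f (n + k)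
    rcases hne.lt_or_gt with hlt | hlt
    exacts [⟨k, l, hlt, h⟩, ⟨l, k, hlt, h.symm⟩]
  have hmono := monotone_rootDegree hp hprim
  have heq : rootDegree τ p (n + k) = rootDegree τ p (n + l) :=
    eq_of_iterate_eq_shift_zpow hinf (hf _) (hfkl ▸ hf _)
  exact ⟨n + k, Nat.le_add_right n k,
    le_antisymm (heq ▸ hmono (by omega)) (hmono (by omega))⟩

/- Desubstituting the first return of `τᵐ⁺¹(X)` inside `τᵐ(X)` shows that a stable degree is prime
to `p`; it also divides `pᵐ`. -/
theorem rootDegree_eq_one_of_succ_eq [Finite A] [Nonempty A] (hp : IsConstantLength τ p)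
    (hprim : IsPrimitive τ) {m : ℕ} (hm : rootDegree τ p (m + 1) = rootDegree τ p m) :
    rootDegree τ p m = 1 := by
  have hdm := returnPeriod_mul_rootDegree hp hprim m
  have hpos := hdm ▸ hp.pow_pos m
  have hd : returnPeriod τ p (m + 1) = p * returnPeriod τ p m := by
    refine Nat.eq_of_mul_eq_mul_right (Nat.pos_of_mul_pos_left hpos) ?_
    rw [← hm, returnPeriod_mul_rootDegree hp hprim, hm, mul_assoc, hdm, pow_succ']
  obtain ⟨x, hx⟩ := subshift_nonempty hp hprim
  obtain ⟨y, hy, hxy⟩ := exists_shift_inflate_eq_of_mem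
    (mem_returnTimes_iff.2 dvd_rfl) (inflate_mem_subshift hp hx 1)
  obtain ⟨j, -, z, hz, rfl⟩ := exists_eq_shift_inflate hp hprim 1 hy
  rw [← shift_zpow_inflate hp, inflate_inflate hp, inflate_inflate hp] at hxy
  have hmem : -((p ^ m : ℕ) * j : ℤ) + returnPeriod τ p m ∈ returnTimes τ p (m + 1) := by
    refine mem_returnTimes hp hprim hx hz ?_
    rw [← shift_zpow_shift_zpow, hxy, shift_zpow_neg_shift_zpow]
  rw [mem_returnTimes_iff, hd, ← hdm] at hmem
  obtain ⟨c, hc⟩ := hmem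
  have hcoprime : IsCoprime (rootDegree τ p m : ℤ) p := by
    refine ⟨j, c, mul_left_cancel₀
      (Int.natCast_ne_zero.2 (Nat.pos_of_mul_pos_right hpos).ne') ?_⟩
    push_cast at hc
    linear_combination -hc
  exact Nat.Coprime.eq_one_of_dvd ((Nat.isCoprime_iff_coprime.1 hcoprime).pow_right m)
    (Dvd.intro_left _ hdm)

theorem pow_dvd_of_shift_inflate_eq [Finite A] (hp : IsConstantLength τ p)
    (hprim : IsPrimitive τ) (hinj : Function.Injective τ) (hinf : (subshift τ).Infinite) {n : ℕ}
    {e : ℤ} {x y : ℤ → A} (hx : x ∈ subshift τ) (hy : y ∈ subshift τ)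
    (hxy : (shift ^ e) (inflate τ p n x) = inflate τ p n y) : ((p ^ n : ℕ) : ℤ) ∣ e := by
  have : Nonempty A := ⟨x 0⟩
  obtain ⟨m, hnm, hm⟩ := exists_rootDegree_succ_eq hp hprim hinj hinf n
  have hn := returnPeriod_mul_rootDegree hp hprim n
  have hle : rootDegree τ p n ≤ 1 :=
    rootDegree_eq_one_of_succ_eq hp hprim hm ▸ monotone_rootDegree hp hprim hnm
  have hpos : 0 < rootDegree τ p n := Nat.pos_of_mul_pos_left (hn ▸ hp.pow_pos n)
  rw [← hn, le_antisymm hle hpos, mul_one]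
  exact mem_returnTimes_iff.1 (mem_returnTimes hp hprim hx hy hxy)

theorem eq_of_shift_inflate_eq [Finite A] (hp : IsConstantLength τ p) (hprim : IsPrimitive τ)
    (hinj : Function.Injective τ) (hinf : (subshift τ).Infinite) {n k l : ℕ} (hk : k < p ^ n)
    (hl : l < p ^ n) {x y : ℤ → A} (hx : x ∈ subshift τ) (hy : y ∈ subshift τ)
    (hxy : (shift ^ (k : ℤ)) (inflate τ p n x) = (shift ^ (l : ℤ)) (inflate τ p n y)) :
    k = l ∧ x = y := by
  have hdvd : ((p ^ n : ℕ) : ℤ) ∣ -l + k := by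
    refine pow_dvd_of_shift_inflate_eq hp hprim hinj hinf hx hy ?_
    rw [← shift_zpow_shift_zpow, hxy, shift_zpow_neg_shift_zpow]
  have hkl : k = l := by
    have := Int.eq_zero_of_abs_lt_dvd hdvd (abs_lt.2 (by omega))
    omega
  subst hkl
  exact ⟨rfl, inflate_injective hp hinj n ((shift ^ (k : ℤ)).injective hxy)⟩

/-! ### The substitution on pairs of letters -/

section Semiconj

variable {B : Type*} {ζ : B → List B} {f : B → A}

theorem iter_map (h : ∀ b, (ζ b).map f = τ (f b)) (n : ℕ) (b : B) :
    (iter ζ n b).map f = iter τ n (f b) := by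
  have hsemi : Function.Semiconj (List.map f) (onWord ζ) (onWord τ) := fun w => by
    simp only [onWord, List.map_flatMap, List.flatMap_map, h]
  exact hsemi.iterate_right n [b]

theorem letter_map (h : ∀ b, (ζ b).map f = τ (f b)) (n : ℕ) (b : B) (j : ℕ) :
    f (letter ζ n b j) = letter τ n (f b) j := by
  rw [letter, letter, ← iter_map h, List.getD_map]

theorem comp_inflate (h : ∀ b, (ζ b).map f = τ (f b)) (n : ℕ) (z : ℤ → B) :
    f ∘ inflate ζ p n z = inflate τ p n (f ∘ z) :=
  funext fun _ => letter_map h n _ _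

theorem comp_shift_zpow (f : B → A) (e : ℤ) (z : ℤ → B) :
    f ∘ (shift ^ e) z = (shift ^ e) (f ∘ z) :=
  funext fun i => by
    rw [Function.comp_apply, shift_zpow_apply, shift_zpow_apply, Function.comp_apply]

end Semiconj

/-- The substitution on pairs of letters which acts as `τ` on both coordinates. -/
def pairSubst (τ : A → List A) (q : A × A) : List (A × A) := (τ q.1).zip (τ q.2)

theorem IsConstantLength.pairSubst (hp : IsConstantLength τ p) :
    IsConstantLength (pairSubst τ) p :=
  ⟨hp.1, fun q => by rw [Substitution.pairSubst, List.length_zip, hp.2, hp.2, min_self]⟩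

theorem map_fst_pairSubst (hp : IsConstantLength τ p) (q : A × A) :
    (pairSubst τ q).map Prod.fst = τ q.1 :=
  List.map_fst_zip (by rw [hp.2, hp.2])

theorem map_snd_pairSubst (hp : IsConstantLength τ p) (q : A × A) :
    (pairSubst τ q).map Prod.snd = τ q.2 :=
  List.map_snd_zip (by rw [hp.2, hp.2])

theorem letter_pairSubst (hp : IsConstantLength τ p) (n : ℕ) (q : A × A) (j : ℕ) :
    letter (pairSubst τ) n q j = (letter τ n q.1 j, letter τ n q.2 j) :=
  Prod.ext (letter_map (map_fst_pairSubst hp) n q j) (letter_map (map_snd_pairSubst hp) n q j)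

theorem letter_pairSubst_mem_diagonal (hp : IsConstantLength τ p) {n : ℕ} {q : A × A}
    (hq : q ∈ Set.diagonal A) (j : ℕ) : letter (pairSubst τ) n q j ∈ Set.diagonal A := by
  rw [Set.mem_diagonal_iff] at hq
  rw [letter_pairSubst hp, Set.mem_diagonal_iff, hq]

theorem exists_append_of_getElem? {l : List A} {a : A} {i d : ℕ} (hi : l[i]? = some a)
    (hd : l[i + 1 + d]? = some a) :
    ∃ u v w, l = u ++ [a] ++ (v ++ [a] ++ w) ∧ u.length = i ∧ v.length = d := by
  have split : ∀ {l : List A} {i : ℕ}, l[i]? = some a →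
      l = l.take i ++ [a] ++ l.drop (i + 1) ∧ (l.take i).length = i := by
    intro l i hi
    obtain ⟨hlt, rfl⟩ := List.getElem?_eq_some_iff.1 hi
    exact ⟨by simp, by simp [hlt.le]⟩
  rw [← List.getElem?_drop] at hd
  refine ⟨l.take i, (l.drop (i + 1)).take d, (l.drop (i + 1)).drop (d + 1), ?_, (split hi).2,
    (split hd).2⟩
  rw [← (split hd).1, ← (split hi).1]

theorem drop_append_singleton {l u r : List A} {a : A} (h : l = u ++ [a] ++ r) :
    l.drop (u.length + 1) = r := by
  simp [h]

theorem CoincidenceCondition.exists_letter_eq (hp : IsConstantLength τ p)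
    (h : CoincidenceCondition τ) : ∃ (m : ℕ) (q : A × A), q ∉ Set.diagonal A ∧ ∃ i j k : ℕ,
      i < j ∧ i < k ∧ j < p ^ m ∧ k < p ^ m ∧ letter (pairSubst τ) m q i = q ∧
      letter (pairSubst τ) m q j = q ∧ letter (pairSubst τ) m q k ∈ Set.diagonal A := by
  obtain ⟨m, a, b, hab, u, v, w, u', v', w', ha, hb, hu, hv, -, -, r, c, hr, hr'⟩ := h
  rw [List.append_assoc _ v, List.append_assoc _ (v ++ [a])] at ha
  rw [List.append_assoc _ v', List.append_assoc _ (v' ++ [b])] at hb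
  have letter_eq {d : A} {t : ℕ} {e : A} (h : (iter τ m d)[t]? = some e) :
      t < p ^ m ∧ letter τ m d t = e := by
    have ht : t < p ^ m := length_iter hp m d ▸ (List.getElem?_eq_some_iff.1 h).1
    exact ⟨ht, Option.some.inj ((getElem?_iter hp ht d).symm.trans h)⟩
  have letter_eq_pair {j : ℕ} (h : letter τ m a j = a) (h' : letter τ m b j = b) :
      letter (pairSubst τ) m (a, b) j = (a, b) := by rw [letter_pairSubst hp, h, h']
  have hai := letter_eq (t := u.length) (e := a) (d := a) (by simp [ha])
  have hbi := letter_eq (t := u.length) (e := b) (d := b) (by simp [hb, hu])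
  have haj := letter_eq (t := u.length + 1 + v.length) (e := a) (d := a)
    (by rw [← List.getElem?_drop, drop_append_singleton ha]; simp)
  have hbj := letter_eq (t := u.length + 1 + v.length) (e := b) (d := b)
    (by rw [← List.getElem?_drop, hu, drop_append_singleton hb, hv]; simp)
  have hak := letter_eq (by rw [← drop_append_singleton ha, List.getElem?_drop] at hr; exact hr)
  have hbk := letter_eq
    (by rw [← drop_append_singleton hb, List.getElem?_drop, ← hu] at hr'; exact hr')
  refine ⟨m, (a, b), hab, u.length, u.length + 1 + v.length, u.length + 1 + r, by omega, by omega,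
    haj.1, hak.1, letter_eq_pair hai.2 hbi.2, letter_eq_pair haj.2 hbj.2, ?_⟩
  rw [letter_pairSubst hp, Set.mem_diagonal_iff, hak.2, hbk.2]

theorem coincidenceCondition_of_letter_eq (hp : IsConstantLength τ p) {m : ℕ} {q : A × A}
    (hq : q ∉ Set.diagonal A) {i j k : ℕ} (hij : i < j) (hik : i < k) (hj : j < p ^ m)
    (hk : k < p ^ m) (hqi : letter (pairSubst τ) m q i = q)
    (hqj : letter (pairSubst τ) m q j = q) (hqk : letter (pairSubst τ) m q k ∈ Set.diagonal A) :
    CoincidenceCondition τ := by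
  obtain ⟨a, b⟩ := q
  simp only [letter_pairSubst hp, Prod.mk.injEq, Set.mem_diagonal_iff] at hqi hqj hqk
  obtain ⟨hai, hbi⟩ := hqi
  obtain ⟨haj, hbj⟩ := hqj
  obtain ⟨d, rfl⟩ := Nat.exists_eq_add_of_le hij
  obtain ⟨r, rfl⟩ := Nat.exists_eq_add_of_le hik
  have getElem?_eq {c e : A} {t : ℕ} (ht : t < p ^ m) (h : letter τ m c t = e) :
      (iter τ m c)[t]? = some e := by rw [getElem?_iter hp ht, h]
  obtain ⟨u, v, w, ha, hu, hv⟩ :=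
    exists_append_of_getElem? (getElem?_eq (by omega) hai) (getElem?_eq hj haj)
  obtain ⟨u', v', w', hb, hu', hv'⟩ :=
    exists_append_of_getElem? (getElem?_eq (by omega) hbi) (getElem?_eq hj hbj)
  have hw : w.length = w'.length := by
    have hla := length_iter hp m a
    have hlb := length_iter hp m b
    simp only [ha, hb, List.length_append, List.length_singleton] at hla hlb
    omega
  refine ⟨m, a, b, hq, u, v, w, u', v', w', by simpa using ha, by simpa using hb,
    hu.trans hu'.symm, hv.trans hv'.symm, hw, by simp [hv, hv', hw], r,
    letter τ m a (i + 1 + r), ?_, ?_⟩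
  · rw [← drop_append_singleton ha, List.getElem?_drop, hu, getElem?_iter hp hk]
  · rw [← drop_append_singleton hb, List.getElem?_drop, hu', getElem?_iter hp hk, ← hqk]

/-! ### Powers of a substitution -/

theorem onWord_iter (m : ℕ) (w : List A) : onWord (iter τ m) w = (onWord τ)^[m] w := by
  induction w with
  | nil => exact (Function.iterate_fixed (show onWord τ [] = [] from rfl) m).symm
  | cons a w ih => rw [onWord, List.flatMap_cons, ← onWord, ih, iter, ← iterate_append,
      List.singleton_append]

theorem iter_iter (m n : ℕ) (a : A) : iter (iter τ m) n a = iter τ (m * n) a := by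
  rw [iter, iter, Function.iterate_mul, funext (onWord_iter (τ := τ) m)]

theorem letter_iter (m n : ℕ) (a : A) (j : ℕ) : letter (iter τ m) n a j = letter τ (m * n) a j := by
  rw [letter, letter, iter_iter]

theorem inflate_iter (m n : ℕ) (x : ℤ → A) :
    inflate (iter τ m) (p ^ m) n x = inflate τ p (m * n) x := by
  unfold inflate
  simp only [letter_iter, pow_mul]

theorem IsConstantLength.iter (hp : IsConstantLength τ p) {m : ℕ} (hm : m ≠ 0) :
    IsConstantLength (Substitution.iter τ m) (p ^ m) :=
  ⟨le_trans hp.1 (Nat.le_self_pow hm p), length_iter hp m⟩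

/-! ### Towers of desubstitutions -/

/-- The number whose `r` base-`b` digits, least significant first, are `ε n, …, ε (n + r - 1)`. -/
def digitValue (b : ℕ) (ε : ℕ → ℕ) (n r : ℕ) : ℕ := Nat.ofDigits b ((List.range' n r).map ε)

section Digits

variable {b : ℕ} {ε : ℕ → ℕ}

theorem digitValue_zero (b : ℕ) (ε : ℕ → ℕ) (n : ℕ) : digitValue b ε n 0 = 0 := rfl

theorem digitValue_one (b : ℕ) (ε : ℕ → ℕ) (n : ℕ) : digitValue b ε n 1 = ε n := by
  simp [digitValue]

theorem digitValue_add (b : ℕ) (ε : ℕ → ℕ) (n r s : ℕ) :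
    digitValue b ε n (r + s) = digitValue b ε n r + b ^ r * digitValue b ε (n + r) s := by
  rw [digitValue, ← List.range'_append_1, List.map_append, Nat.ofDigits_append, List.length_map,
    List.length_range', digitValue, digitValue]

theorem digitValue_congr {ε' : ℕ → ℕ} {n : ℕ} (h : ∀ k ≥ n, ε k = ε' k) (r : ℕ) :
    digitValue b ε n r = digitValue b ε' n r :=
  congrArg (Nat.ofDigits b) (List.map_congr_left fun _ hk => h _ (List.mem_range'_1.1 hk).1)

theorem digitValue_lt (hb : 1 < b) (h : ∀ k, ε k < b) (n r : ℕ) : digitValue b ε n r < b ^ r := by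
  have := Nat.ofDigits_lt_base_pow_length hb (l := (List.range' n r).map ε)
    (List.forall_mem_map.2 fun k _ => h k)
  rwa [List.length_map, List.length_range'] at this

theorem digitValue_add_pow_lt (hb : 1 < b) (h : ∀ k, ε k < b) {n l r : ℕ}
    (hl : ε (n + l) + 1 < b) (hlr : l < r) : digitValue b ε n r + b ^ l < b ^ r := by
  obtain ⟨s, rfl⟩ := Nat.exists_eq_add_of_le (Nat.succ_le_of_lt hlr)
  rw [Nat.succ_eq_add_one, digitValue_add, digitValue_add, digitValue_one]
  have hlow : digitValue b ε n l + b ^ l * ε (n + l) + b ^ l < b ^ (l + 1) :=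
    calc _ < b ^ l * (ε (n + l) + 2) := by linarith [digitValue_lt hb h n l]
      _ ≤ b ^ (l + 1) := by rw [pow_succ]; exact Nat.mul_le_mul_left _ hl
  calc _ < b ^ (l + 1) * (digitValue b ε (n + (l + 1)) s + 1) := by linarith
    _ ≤ b ^ (l + 1) * b ^ s := Nat.mul_le_mul_left _ (digitValue_lt hb h _ s)
    _ = b ^ (l + 1 + s) := (pow_add ..).symm

end Digits

/-- The points `x n` are successive desubstitutions of `x 0`: `x n = T^{ε n} τ(x (n + 1))`, where
the digit `ε n` is the position of the origin of `x n` inside a word `τ(a)`. -/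
structure IsTower (τ : A → List A) (p : ℕ) (ε : ℕ → ℕ) (x : ℕ → ℤ → A) : Prop where
  lt : ∀ n, ε n < p
  eq_shift_inflate_succ : ∀ n, x n = (shift ^ (ε n : ℤ)) (inflate τ p 1 (x (n + 1)))

namespace IsTower

variable {ε ε' : ℕ → ℕ} {x x' : ℕ → ℤ → A}

theorem map {B : Type*} {ζ : B → List B} {f : B → A} {z : ℕ → ℤ → B} (hz : IsTower ζ p ε z)
    (h : ∀ b, (ζ b).map f = τ (f b)) : IsTower τ p ε fun n => f ∘ z n :=
  ⟨hz.lt, fun n => by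
    rw [hz.eq_shift_inflate_succ n, comp_shift_zpow, comp_inflate h]⟩

theorem eq_shift_inflate (hx : IsTower τ p ε x) (hp : IsConstantLength τ p) (n r : ℕ) :
    x n = (shift ^ (digitValue p ε n r : ℤ)) (inflate τ p r (x (n + r))) := by
  induction r with
  | zero => simp [digitValue_zero, inflate_zero hp]
  | succ r ih =>
    rw [ih, hx.eq_shift_inflate_succ (n + r), ← shift_zpow_inflate hp, shift_zpow_shift_zpow,
      inflate_inflate hp, digitValue_add, digitValue_one, Nat.cast_add, Nat.cast_mul, add_assoc]

theorem digitValue_lt (hx : IsTower τ p ε x) (hp : IsConstantLength τ p) (n r : ℕ) :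
    digitValue p ε n r < p ^ r :=
  Substitution.digitValue_lt hp.1 hx.lt n r

theorem apply_natCast (hx : IsTower τ p ε x) (hp : IsConstantLength τ p) {n r t : ℕ}
    (ht : digitValue p ε n r + t < p ^ r) :
    x n t = letter τ r (x (n + r) 0) (digitValue p ε n r + t) := by
  rw [← inflate_natCast hp ht, hx.eq_shift_inflate hp n r, shift_zpow_apply, Nat.cast_add,
    add_comm (t : ℤ)]

theorem apply_zero (hx : IsTower τ p ε x) (hp : IsConstantLength τ p) (n r : ℕ) :
    x n 0 = letter τ r (x (n + r) 0) (digitValue p ε n r) :=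
  hx.apply_natCast hp (t := 0) (hx.digitValue_lt hp n r)

theorem exists_forall_add_lt (hx : IsTower τ p ε x) (hp : IsConstantLength τ p)
    (hε : ∃ᶠ n in atTop, ε n ≠ p - 1) (n t : ℕ) :
    ∃ R, ∀ r ≥ R, digitValue p ε n r + t < p ^ r := by
  obtain ⟨N, hN, hεN⟩ := frequently_atTop.1 hε (n + t)
  obtain ⟨l, rfl⟩ := Nat.exists_eq_add_of_le ((Nat.le_add_right _ _).trans hN)
  have hlt := hx.lt (n + l)
  refine ⟨l + 1, fun r hr => ?_⟩
  have hpow : l < p ^ l := Nat.lt_pow_self hp.1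
  have := digitValue_add_pow_lt hp.1 hx.lt (n := n) (l := l) (r := r) (by omega) (by omega)
  omega

theorem eq_of_frequently_eq (hx : IsTower τ p ε x) (hx' : IsTower τ p ε' x')
    (hp : IsConstantLength τ p) {n : ℕ} (hε : ∀ k ≥ n, ε k = ε' k)
    (hfreq : ∃ᶠ k in atTop, x k (-1) = x' k (-1) ∧ x k 0 = x' k 0 ∧ x k 1 = x' k 1) :
    x n = x' n := by
  funext i
  obtain ⟨k, hk, hleft, hzero, hright⟩ := frequently_atTop.1 hfreq (n + i.natAbs)
  obtain ⟨r, rfl⟩ := Nat.exists_eq_add_of_le ((Nat.le_add_right _ _).trans hk)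
  have hr : r < p ^ r := Nat.lt_pow_self hp.1
  have hlt := hx.digitValue_lt hp n r
  rw [hx.eq_shift_inflate hp n r, hx'.eq_shift_inflate hp n r, ← digitValue_congr hε,
    shift_zpow_apply, shift_zpow_apply]
  obtain ⟨t, j, hj, htj⟩ := exists_eq_mul_add_of_pos (hp.pow_pos r) (i + digitValue p ε n r)
  rw [htj, inflate_mul_add hp hj, inflate_mul_add hp hj]
  have ht : t = -1 ∨ t = 0 ∨ t = 1 := by
    have hpos : (0 : ℤ) ≤ (p ^ r : ℕ) := Int.natCast_nonneg _
    have hlower : -1 < t + 1 := lt_of_mul_lt_mul_left (by rw [mul_add]; omega) hpos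
    have hupper : t < 2 := lt_of_mul_lt_mul_left (by omega) hpos
    omega
  rcases ht with rfl | rfl | rfl
  · rw [hleft]
  · rw [hzero]
  · rw [hright]

theorem digits_eq [Finite A] {m : ℕ} (hx : IsTower (iter τ m) (p ^ m) ε x)
    (hx' : IsTower (iter τ m) (p ^ m) ε' x') (hp : IsConstantLength τ p) (hprim : IsPrimitive τ)
    (hinj : Function.Injective τ) (hinf : (subshift τ).Infinite) (hmem : ∀ n, x n ∈ subshift τ)
    (hmem' : ∀ n, x' n ∈ subshift τ) (h : x 0 = x' 0) : ε = ε' := by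
  have step : ∀ n, x n = x' n → ε n = ε' n ∧ x (n + 1) = x' (n + 1) := fun n hn => by
    rw [hx.eq_shift_inflate_succ, hx'.eq_shift_inflate_succ, inflate_iter, inflate_iter,
      mul_one] at hn
    exact eq_of_shift_inflate_eq hp hprim hinj hinf (hx.lt n) (hx'.lt n) (hmem _) (hmem' _) hn
  have hpoint : ∀ n, x n = x' n := fun n => by
    induction n with
    | zero => exact h
    | succ n ih => exact (step n ih).2
  exact funext fun n => (step n (hpoint n)).1

end IsTower

/-! ### Li–Yorke pairs in terms of coordinates -/

section LimsupLiminf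

variable {ι : Type*} {f : Filter ι} [f.NeBot] {u : ι → ℝ} {C : ℝ}

theorem limsup_pos_iff (h0 : ∀ n, 0 ≤ u n) (hC : ∀ n, u n ≤ C) :
    0 < limsup u f ↔ ∃ c > 0, ∃ᶠ n in f, c < u n := by
  have hle : IsBoundedUnder (· ≤ ·) f u := isBoundedUnder_of ⟨C, hC⟩
  have hge : IsBoundedUnder (· ≥ ·) f u := isBoundedUnder_of ⟨0, h0⟩
  constructor
  · intro h
    obtain ⟨c, hc, hcu⟩ := exists_between h
    exact ⟨c, hc, frequently_lt_of_lt_limsup hge.isCoboundedUnder_le hcu⟩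
  · rintro ⟨c, hc, hfreq⟩
    exact hc.trans_le (le_limsup_of_frequently_le (hfreq.mono fun _ => le_of_lt) hle)

theorem liminf_eq_zero_iff (h0 : ∀ n, 0 ≤ u n) (hC : ∀ n, u n ≤ C) :
    liminf u f = 0 ↔ ∀ c > 0, ∃ᶠ n in f, u n < c := by
  have hle : IsBoundedUnder (· ≤ ·) f u := isBoundedUnder_of ⟨C, hC⟩
  have hge : IsBoundedUnder (· ≥ ·) f u := isBoundedUnder_of ⟨0, h0⟩
  constructor
  · intro h c hc
    exact frequently_lt_of_liminf_lt hle.isCoboundedUnder_ge (h.trans_lt hc)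
  · intro h
    refine le_antisymm (le_of_forall_pos_le_add fun c hc => ?_)
      (le_liminf_of_le hle.isCoboundedUnder_ge (Eventually.of_forall h0))
    rw [zero_add]
    exact liminf_le_of_frequently_le ((h c hc).mono fun _ => le_of_lt) hge

end LimsupLiminf

theorem seqDist_nonneg (x y : ℤ → A) : 0 ≤ seqDist x y := by
  unfold seqDist; split_ifs <;> positivity

theorem seqDist_le_one (x y : ℤ → A) : seqDist x y ≤ 1 := by
  unfold seqDist
  split_ifs
  · exact zero_le_one
  · exact pow_le_one₀ (by norm_num) (by norm_num)

theorem seqDist_lt_iff {x y : ℤ → A} {L : ℕ} :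
    seqDist x y < (1 / 2 : ℝ) ^ L ↔ ∀ i : ℤ, i.natAbs ≤ L → x i = y i := by
  unfold seqDist
  split_ifs with h
  · subst h
    simp only [implies_true, iff_true]
    positivity
  · have hne : {n : ℕ | ∃ i : ℤ, i.natAbs = n ∧ x i ≠ y i}.Nonempty := by
      obtain ⟨i, hi⟩ := Function.ne_iff.1 h
      exact ⟨_, i, rfl, hi⟩
    rw [pow_lt_pow_iff_right_of_lt_one₀ (by norm_num) (by norm_num), ← Nat.add_one_le_iff,
      le_csInf_iff (OrderBot.bddBelow _) hne]
    refine ⟨fun H i hi => ?_, ?_⟩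
    · by_contra hxy
      have := H _ ⟨i, rfl, hxy⟩
      omega
    · rintro H n ⟨i, rfl, hxy⟩
      by_contra hlt
      exact hxy (H i (by omega))

theorem shift_iterate_apply (n : ℕ) (x : ℤ → A) (i : ℤ) : (shift^[n] x) i = x (n + i) := by
  rw [← Equiv.Perm.coe_pow, ← zpow_natCast, shift_zpow_apply, add_comm]

/-- The coordinate form of a Li–Yorke pair, for a pair of sequences encoded as a sequence of pairs:
to the right, the two sequences differ infinitely often and agree on arbitrarily long intervals. -/
def IsLiYorke (z : ℤ → A × A) : Prop :=
  (∃ᶠ n : ℕ in atTop, z n ∉ Set.diagonal A) ∧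
    ∀ L : ℕ, ∃ᶠ n : ℕ in atTop, ∀ i < L, z (n + i : ℕ) ∈ Set.diagonal A

theorem isLiYorkePair_iff {x y : ℤ → A} :
    IsLiYorkePair seqDist shift x y ↔ IsLiYorke fun t => (x t, y t) := by
  set u : ℕ → ℝ := fun n => seqDist (shift^[n] x) (shift^[n] y) with hu
  have h0 : ∀ n, 0 ≤ u n := fun n => seqDist_nonneg _ _
  have h1 : ∀ n, u n ≤ 1 := fun n => seqDist_le_one _ _
  have hlt : ∀ n L, u n < (1 / 2 : ℝ) ^ L ↔ ∀ i : ℤ, i.natAbs ≤ L → x (n + i) = y (n + i) :=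
    fun n L => by simp only [hu, seqDist_lt_iff, shift_iterate_apply]
  have exists_pow_lt {c : ℝ} (hc : 0 < c) : ∃ L : ℕ, (1 / 2 : ℝ) ^ L < c :=
    exists_pow_lt_of_lt_one hc (by norm_num)
  refine and_congr ((limsup_pos_iff h0 h1).trans ⟨?_, fun h => ?_⟩)
    ((liminf_eq_zero_iff h0 h1).trans ⟨fun h L => ?_, fun h c hc => ?_⟩)
  · rintro ⟨c, hc, hfreq⟩
    obtain ⟨L, hL⟩ := exists_pow_lt hc
    refine frequently_atTop.2 fun N => ?_
    obtain ⟨n, hn, hcn⟩ := frequently_atTop.1 hfreq (N + L)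
    obtain ⟨i, hi, hne⟩ : ∃ i : ℤ, i.natAbs ≤ L ∧ x (n + i) ≠ y (n + i) := by
      simpa only [not_forall, exists_prop] using mt (hlt n L).2 (hL.trans hcn).not_gt
    refine ⟨(n + i).toNat, by omega, ?_⟩
    rwa [Int.toNat_of_nonneg (by omega)]
  · refine ⟨1 / 2, by norm_num, h.mono fun n hn => ?_⟩
    have : ¬ u n < (1 / 2 : ℝ) ^ 0 := fun hun => hn (by simpa using (hlt n 0).1 hun 0 le_rfl)
    linarith
  · refine frequently_atTop.2 fun N => ?_
    obtain ⟨n, hn, hun⟩ := frequently_atTop.1 (h _ (by positivity : (0 : ℝ) < (1 / 2) ^ L)) N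
    refine ⟨n, hn, fun i hi => ?_⟩
    simpa using (hlt n L).1 hun i (by omega)
  · obtain ⟨L, hL⟩ := exists_pow_lt hc
    refine frequently_atTop.2 fun N => ?_
    obtain ⟨n, hn, hdiag⟩ := frequently_atTop.1 (h (2 * L + 1)) N
    refine ⟨n + L, by omega, ((hlt (n + L) L).2 fun i hi => ?_).trans hL⟩
    have := hdiag (L + i).toNat (by omega)
    rwa [Nat.cast_add, Int.toNat_of_nonneg (by omega), ← add_assoc, ← Nat.cast_add] at this

/-! ### Uncountably many Li–Yorke pairs -/

theorem exists_forall_eq_succ {X : Type*} [TopologicalSpace X] [CompactSpace X] [T2Space X]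
    [Nonempty X] {Φ : ℕ → X → X} (hΦ : ∀ n, Continuous (Φ n)) :
    ∃ x : ℕ → X, ∀ n, x n = Φ n (x (n + 1)) := by
  let C : ℕ → Set (ℕ → X) := fun N => {x | ∀ n < N, x n = Φ n (x (n + 1))}
  have hclosed : ∀ N, IsClosed (C N) := fun N => by
    simp only [C, Set.ofPred_forall]
    exact isClosed_biInter fun n _ =>
      isClosed_eq (continuous_apply n) ((hΦ n).comp (continuous_apply (n + 1)))
  have hnonempty : ∀ (N : ℕ) (Ψ : ℕ → X → X), ∃ x : ℕ → X, ∀ n < N, x n = Ψ n (x (n + 1)) := by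
    intro N
    induction N with
    | zero => exact fun _ => ⟨fun _ => Classical.arbitrary X, fun n hn => absurd hn n.not_lt_zero⟩
    | succ N ih =>
      intro Ψ
      obtain ⟨x, hx⟩ := ih fun n => Ψ (n + 1)
      refine ⟨fun n => n.casesOn (Ψ 0 (x 0)) x, fun n hn => ?_⟩
      cases n with
      | zero => rfl
      | succ n => exact hx n (Nat.lt_of_succ_lt_succ hn)
  obtain ⟨x, hx⟩ := IsCompact.nonempty_iInter_of_sequence_nonempty_isCompact_isClosed C
    (fun N x hx n hn => hx n (hn.trans N.lt_succ_self)) (fun N => hnonempty N Φ)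
    (hclosed 0).isCompact hclosed
  exact ⟨x, fun n => Set.mem_iInter.1 hx (n + 1) n n.lt_succ_self⟩

theorem exists_mem_subshift_apply_zero_eq (hp : IsConstantLength τ p) (hprim : IsPrimitive τ)
    (a : A) : ∃ x ∈ subshift τ, x 0 = a := by
  obtain ⟨x, hx, k, hk⟩ := appears_subshift hp hprim 0 a
  refine ⟨(shift ^ k) x, shift_zpow_mem_subshift hx k, ?_⟩
  rw [shift_zpow_apply, zero_add]
  simpa [word, iter] using hk

/-- The product `X_τ × X_τ`, its points being encoded as sequences of pairs of letters. -/
def pairSubshift (τ : A → List A) : Set (ℤ → A × A) :=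
  {z | Prod.fst ∘ z ∈ subshift τ ∧ Prod.snd ∘ z ∈ subshift τ}

theorem isClosed_pairSubshift [TopologicalSpace A] [DiscreteTopology A] :
    IsClosed (pairSubshift τ) :=
  .inter (isClosed_subshift.preimage (f := fun z : ℤ → A × A => Prod.fst ∘ z) (by fun_prop))
    (isClosed_subshift.preimage (f := fun z : ℤ → A × A => Prod.snd ∘ z) (by fun_prop))

theorem shift_zpow_inflate_mem_pairSubshift (hp : IsConstantLength τ p) {z : ℤ → A × A}
    (hz : z ∈ pairSubshift τ) (e : ℤ) (n : ℕ) :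
    (shift ^ e) (inflate (pairSubst τ) p n z) ∈ pairSubshift τ := by
  constructor
  · rw [comp_shift_zpow, comp_inflate (map_fst_pairSubst hp)]
    exact shift_zpow_mem_subshift (inflate_mem_subshift hp hz.1 n) e
  · rw [comp_shift_zpow, comp_inflate (map_snd_pairSubst hp)]
    exact shift_zpow_mem_subshift (inflate_mem_subshift hp hz.2 n) e

theorem exists_isTower [Finite A] (hp : IsConstantLength τ p) (hprim : IsPrimitive τ) {m : ℕ}
    {q : A × A} {ε : ℕ → ℕ} (hlt : ∀ n, ε n < p ^ m)
    (hε : ∀ n, letter (pairSubst τ) m q (ε n) = q) :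
    ∃ z, IsTower (iter (pairSubst τ) m) (p ^ m) ε z ∧ ∀ n, z n ∈ pairSubshift τ ∧ z n 0 = q := by
  let _ : TopologicalSpace A := ⊥
  have : DiscreteTopology A := ⟨rfl⟩
  let K : Set (ℤ → A × A) := {z | z ∈ pairSubshift τ ∧ z 0 = q}
  let Φ : ℕ → (ℤ → A × A) → ℤ → A × A :=
    fun n z => (shift ^ (ε n : ℤ)) (inflate (pairSubst τ) p m z)
  have hK : IsClosed K :=
    isClosed_pairSubshift.inter (isClosed_eq (continuous_apply 0) continuous_const)
  have hΦ : ∀ n, Continuous (Φ n) := fun n => (continuous_shift_zpow _).comp (continuous_inflate m)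
  have hmaps : ∀ n, Set.MapsTo (Φ n) K K := fun n z ⟨hz, hz0⟩ =>
    ⟨shift_zpow_inflate_mem_pairSubshift hp hz _ _, by
      simp only [Φ]
      rw [shift_zpow_apply, zero_add, inflate_natCast hp.pairSubst (hlt n), hz0, hε]⟩
  obtain ⟨x, hx, hx0⟩ := exists_mem_subshift_apply_zero_eq hp hprim q.1
  obtain ⟨y, hy, hy0⟩ := exists_mem_subshift_apply_zero_eq hp hprim q.2
  have : Nonempty K := ⟨⟨fun t => (x t, y t), ⟨hx, hy⟩, Prod.ext hx0 hy0⟩⟩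
  have : CompactSpace K := isCompact_iff_compactSpace.1 hK.isCompact
  obtain ⟨z, hz⟩ := exists_forall_eq_succ fun n => (hΦ n).restrict (hmaps n)
  refine ⟨fun n => z n, ⟨hlt, fun n => ?_⟩, fun n => (z n).2⟩
  rw [inflate_iter, mul_one]
  exact congrArg Subtype.val (hz n)

theorem IsTower.isLiYorke (hp : IsConstantLength τ p) {m : ℕ} {q : A × A} {ε : ℕ → ℕ}
    {z : ℕ → ℤ → A × A} (hz : IsTower (iter (pairSubst τ) m) (p ^ m) ε z) (hz0 : ∀ n, z n 0 = q)
    (hq : q ∉ Set.diagonal A) {i j k : ℕ} (hij : i < j) (hik : i < k) (hj : j < p ^ m)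
    (hk : k < p ^ m) (hqj : letter (pairSubst τ) m q j = q)
    (hqk : letter (pairSubst τ) m q k ∈ Set.diagonal A) (hε : ∃ᶠ n in atTop, ε n = i) :
    IsLiYorke (z 0) := by
  set P := p ^ m
  have hσ : IsConstantLength (iter (pairSubst τ) m) P :=
    hp.pairSubst.iter (by rintro rfl; simp [P] at hj; omega)
  have apply_eq {n l s t : ℕ} (hn : ε n = i) (hl : l < P) (hs : s < P ^ n)
      (ht : digitValue P ε 0 n + i * P ^ n + t = l * P ^ n + s) :
      z 0 t = letter (iter (pairSubst τ) m) n (letter (pairSubst τ) m q l) s := by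
    have hdigit : digitValue P ε 0 (n + 1) + t = l * P ^ n + s := by
      rw [digitValue_add, digitValue_one, zero_add, hn, mul_comm (P ^ n), ht]
    have hlt := mul_add_lt_mul hl hs
    rw [← pow_succ', ← hdigit] at hlt
    rw [hz.apply_natCast hσ hlt, hdigit, hz0, letter_add hσ (by rwa [pow_one]) hs, letter_iter m 1,
      mul_one]
  have lt_pow (n : ℕ) : n < P ^ n := Nat.lt_pow_self hσ.1
  obtain ⟨c, rfl⟩ := Nat.exists_eq_add_of_lt hij
  obtain ⟨d, rfl⟩ := Nat.exists_eq_add_of_lt hik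
  refine ⟨frequently_atTop.2 fun N => ?_, fun L => frequently_atTop.2 fun N => ?_⟩
  · obtain ⟨n, hn, hεn⟩ := frequently_atTop.1 hε N
    refine ⟨(c + 1) * P ^ n, ?_, ?_⟩
    · linarith [lt_pow n, Nat.zero_le (c * P ^ n)]
    · rw [apply_eq hεn hj (hz.digitValue_lt hσ 0 n) (by ring), hqj, ← hz0 (0 + n),
        ← hz.apply_zero hσ, hz0]
      exact hq
  · obtain ⟨n, hn, hεn⟩ := frequently_atTop.1 hε (N + L)
    have hD := hz.digitValue_lt hσ 0 n
    refine ⟨(d + 1) * P ^ n - digitValue P ε 0 n + N, Nat.le_add_left .., fun s hs => ?_⟩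
    have hle : digitValue P ε 0 n ≤ (d + 1) * P ^ n := by
      linarith [Nat.zero_le (d * P ^ n)]
    rw [apply_eq (s := N + s) hεn hk (by have := lt_pow n; omega) (by zify [hle]; ring),
      letter_iter]
    exact letter_pairSubst_mem_diagonal hp hqk _

theorem not_countable_of_coincidenceCondition [Finite A] (hp : IsConstantLength τ p)
    (hprim : IsPrimitive τ) (hinj : Function.Injective τ) (hinf : (subshift τ).Infinite)
    (h : CoincidenceCondition τ) : ¬ (liYorkePairs τ).Countable := by
  obtain ⟨m, q, hq, i, j, k, hij, hik, hj, hk, hqi, hqj, hqk⟩ := h.exists_letter_eq hp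
  classical
  let ε : Set ℕ → ℕ → ℕ := fun S n => if Even n ∨ n / 2 ∈ S then i else j
  have hcases (S : Set ℕ) (n : ℕ) : ε S n = i ∨ ε S n = j := ite_eq_or_eq ..
  have hfreq (S : Set ℕ) : ∃ᶠ n in atTop, ε S n = i :=
    Nat.frequently_even.mono fun n hn => if_pos (Or.inl hn)
  have hmem_iff (S : Set ℕ) (n : ℕ) : n ∈ S ↔ ε S (2 * n + 1) = i := by
    have hhalf : (2 * n + 1) / 2 = n := by omega
    simp only [ε, hhalf, Nat.not_even_bit1, false_or, ite_eq_left_iff, hij.ne', imp_false, not_not]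
  choose z hz hmem using fun S => exists_isTower hp hprim (q := q) (m := m) (ε := ε S)
    (fun n => by rcases hcases S n with h | h <;> omega)
    (fun n => by rcases hcases S n with h | h <;> rwa [h])
  have hLY (S : Set ℕ) : (Prod.fst ∘ z S 0, Prod.snd ∘ z S 0) ∈ liYorkePairs τ :=
    ⟨(hmem S 0).1.1, (hmem S 0).1.2, isLiYorkePair_iff.2 <|
      (hz S).isLiYorke hp (fun n => (hmem S n).2) hq hij hik hj hk hqj hqk (hfreq S)⟩
  have hinjective : Function.Injective
      fun S => (⟨(Prod.fst ∘ z S 0, Prod.snd ∘ z S 0), hLY S⟩ : liYorkePairs τ) := fun S S' h => by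
    have hε : ε S = ε S' := ((hz S).map (iter_map (map_fst_pairSubst hp) m)).digits_eq
      ((hz S').map (iter_map (map_fst_pairSubst hp) m)) hp hprim hinj hinf
      (fun n => (hmem S n).1.1) (fun n => (hmem S' n).1.1)
      (congrArg (fun r : liYorkePairs τ => r.1.1) h)
    exact Set.ext fun n => by rw [hmem_iff, hmem_iff, hε]
  intro hcount
  have : Countable (liYorkePairs τ) := hcount
  have : Countable (Set ℕ) := hinjective.countable
  obtain ⟨f, hf⟩ := exists_surjective_nat (Set ℕ)
  exact Function.cantor_surjective f hf

/-! ### Desubstitution of Li–Yorke pairs -/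

theorem exists_forall_apply_mem {B : Type*} [Finite B] [TopologicalSpace B] [DiscreteTopology B]
    {K : Set (ℤ → B)} (hK : IsClosed K) {b : ℕ} (hb : 0 < b)
    (hshift : ∀ t : ℤ, ∀ z ∈ K, (shift ^ (b * t : ℤ)) z ∈ K) {D : Set B}
    (h : ∀ L : ℕ, ∃ z ∈ K, ∃ n : ℤ, ∀ i < L, z (n + i) ∈ D) : ∃ z ∈ K, ∀ i, z i ∈ D := by
  let C : ℕ → Set (ℤ → B) := fun L => K ∩ ⋂ (i : ℤ) (_ : i.natAbs ≤ L), {z | z i ∈ D}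
  have hC : ∀ L, IsClosed (C L) := fun L => hK.inter <| isClosed_biInter fun i _ =>
    (isClosed_discrete D).preimage (continuous_apply i)
  have hanti : ∀ L, C (L + 1) ⊆ C L := fun L z hz =>
    ⟨hz.1, Set.mem_iInter₂.2 fun i hi => Set.mem_iInter₂.1 hz.2 i (hi.trans L.le_succ)⟩
  have hnonempty : ∀ L, (C L).Nonempty := fun L => by
    obtain ⟨z, hz, n, hn⟩ := h (2 * L + b + 1)
    obtain ⟨t, j, hj, htj⟩ := exists_eq_mul_add_of_pos hb (n + L + b)
    refine ⟨_, hshift t z hz, Set.mem_iInter₂.2 fun i hi => ?_⟩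
    have := hn (i + b * t - n).toNat (by omega)
    rw [Int.toNat_of_nonneg (by omega), add_sub_cancel] at this
    rwa [Set.mem_ofPred_eq, shift_zpow_apply]
  obtain ⟨z, hz⟩ := IsCompact.nonempty_iInter_of_sequence_nonempty_isCompact_isClosed C hanti
    hnonempty (hC 0).isCompact hC
  rw [Set.mem_iInter] at hz
  exact ⟨z, (hz 0).1, fun i => Set.mem_iInter₂.1 (hz i.natAbs).2 i le_rfl⟩

theorem offset_eq_of_agreeing_windows [Finite A] (hp : IsConstantLength τ p) (hprim : IsPrimitive τ)
    (hinj : Function.Injective τ) (hinf : (subshift τ).Infinite) {k l : ℕ} {x y : ℤ → A}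
    (hk : k < p) (hl : l < p) (hx : x ∈ subshift τ) (hy : y ∈ subshift τ)
    (h : ∀ L : ℕ, ∃ n : ℤ, ∀ i < L, (shift ^ (k : ℤ)) (inflate τ p 1 x) (n + i) =
      (shift ^ (l : ℤ)) (inflate τ p 1 y) (n + i)) : k = l := by
  let _ : TopologicalSpace A := ⊥
  have : DiscreteTopology A := ⟨rfl⟩
  let Ψ : (ℤ → A) × (ℤ → A) → ℤ → A × A := fun r i =>
    ((shift ^ (k : ℤ)) (inflate τ p 1 r.1) i, (shift ^ (l : ℤ)) (inflate τ p 1 r.2) i)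
  have hΨ : Continuous Ψ := continuous_pi fun i => .prodMk
    ((continuous_apply i).comp <| (continuous_shift_zpow _).comp <|
      (continuous_inflate 1).comp continuous_fst)
    ((continuous_apply i).comp <| (continuous_shift_zpow _).comp <|
      (continuous_inflate 1).comp continuous_snd)
  have apply_shift (e t i : ℤ) (w : ℤ → A) : (shift ^ e) (inflate τ p 1 ((shift ^ t) w)) i =
      (shift ^ e) (inflate τ p 1 w) (i + p * t) := by
    simp only [← shift_zpow_inflate hp, pow_one, shift_zpow_apply, add_right_comm]
  obtain ⟨_, ⟨⟨u, v⟩, ⟨hu, hv⟩, rfl⟩, huv⟩ := exists_forall_apply_mem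
    (K := Ψ '' subshift τ ×ˢ subshift τ) (D := Set.diagonal A)
    ((isCompact_subshift.prod isCompact_subshift).image hΨ).isClosed hp.pos
    (by
      rintro t _ ⟨⟨u, v⟩, ⟨hu, hv⟩, rfl⟩
      refine ⟨((shift ^ t) u, (shift ^ t) v),
        ⟨shift_zpow_mem_subshift hu t, shift_zpow_mem_subshift hv t⟩, funext fun i => ?_⟩
      exact (Prod.ext (apply_shift ..) (apply_shift ..)).trans (shift_zpow_apply ..).symm)
    fun L => ⟨_, ⟨(x, y), ⟨hx, hy⟩, rfl⟩, h L⟩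
  exact (eq_of_shift_inflate_eq hp hprim hinj hinf (by rwa [pow_one]) (by rwa [pow_one]) hu hv
    (funext huv)).1

theorem IsLiYorke.of_shift_inflate (hp : IsConstantLength τ p) (hinj : Function.Injective τ)
    {k : ℕ} {z : ℤ → A × A} (h : IsLiYorke ((shift ^ (k : ℤ)) (inflate (pairSubst τ) p 1 z))) :
    IsLiYorke z := by
  have apply_eq {n t j : ℕ} (hj : j < p) (hn : n + k = p * t + j) :
      (shift ^ (k : ℤ)) (inflate (pairSubst τ) p 1 z) n = letter (pairSubst τ) 1 (z t) j := by
    rw [← inflate_mul_add hp.pairSubst (by rwa [pow_one]), shift_zpow_apply, pow_one]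
    exact congrArg _ (by exact_mod_cast hn)
  have hdiv : Tendsto (fun n => (n + k) / p) atTop atTop :=
    (Nat.tendsto_div_const_atTop hp.pos.ne').comp (tendsto_add_atTop_nat k)
  refine ⟨hdiv.frequently (h.1.mono fun n hn hz => hn ?_), fun L =>
    ((tendsto_add_atTop_nat 1).comp hdiv).frequently ((h.2 (p * L + p)).mono fun n hn i hi => ?_)⟩
  · rw [apply_eq (Nat.mod_lt _ hp.pos) (Nat.div_add_mod _ p).symm]
    exact letter_pairSubst_mem_diagonal hp hz _
  · refine eq_of_letter_eq hp hinj (n := 1) fun s hs => ?_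
    rw [pow_one] at hs
    have hmod := Nat.div_add_mod (n + k) p
    have hlt := Nat.mod_lt (n + k) hp.pos
    have hi' : p * i + p ≤ p * L := by rw [← mul_add_one]; exact Nat.mul_le_mul_left p hi
    have hmul : p * ((n + k) / p + 1 + i) = p * ((n + k) / p) + p + p * i := by ring
    have := hn (p * ((n + k) / p + 1 + i) + s - (n + k)) (by omega)
    rwa [apply_eq hs (t := (n + k) / p + 1 + i) (by omega), letter_pairSubst hp] at this

theorem exists_desubstitution [Finite A] (hp : IsConstantLength τ p) (hprim : IsPrimitive τ)
    (hinj : Function.Injective τ) (hinf : (subshift τ).Infinite) {z : ℤ → A × A}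
    (hz : z ∈ pairSubshift τ) (hLY : IsLiYorke z) :
    ∃ k < p, ∃ z' ∈ pairSubshift τ, IsLiYorke z' ∧
      z = (shift ^ (k : ℤ)) (inflate (pairSubst τ) p 1 z') := by
  obtain ⟨k, hk, x, hx, hxz⟩ := exists_eq_shift_inflate hp hprim 1 hz.1
  obtain ⟨l, hl, y, hy, hyz⟩ := exists_eq_shift_inflate hp hprim 1 hz.2
  rw [pow_one] at hk hl
  obtain rfl : k = l := offset_eq_of_agreeing_windows hp hprim hinj hinf hk hl hx hy fun L => by
    obtain ⟨n, hn⟩ := (hLY.2 L).exists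
    rw [← hxz, ← hyz]
    exact ⟨n, hn⟩
  have hz' : z = (shift ^ (k : ℤ)) (inflate (pairSubst τ) p 1 fun t => (x t, y t)) := by
    have hfst := comp_shift_zpow Prod.fst k (inflate (pairSubst τ) p 1 fun t => (x t, y t))
    have hsnd := comp_shift_zpow Prod.snd k (inflate (pairSubst τ) p 1 fun t => (x t, y t))
    rw [comp_inflate (map_fst_pairSubst hp)] at hfst
    rw [comp_inflate (map_snd_pairSubst hp)] at hsnd
    exact funext fun i => Prod.ext (congrFun (hxz.trans hfst.symm) i)
      (congrFun (hyz.trans hsnd.symm) i)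
  exact ⟨k, hk, fun t => (x t, y t), ⟨hx, hy⟩, .of_shift_inflate hp hinj (hz' ▸ hLY), hz'⟩

/-! ### Finitely many orbits of Li–Yorke pairs -/

/-- A tower of Li–Yorke pairs with the letter pair `q` at the origin of infinitely many levels. -/
structure IsLiYorkeTower (τ : A → List A) (p : ℕ) (ε : ℕ → ℕ) (q : A × A) (z : ℕ → ℤ → A × A) :
    Prop extends IsTower (pairSubst τ) p ε z where
  isLiYorke : ∀ n, IsLiYorke (z n)
  frequently_eq : ∃ᶠ n in atTop, z n 0 = q

theorem exists_frequently_eq {S : Type*} [Finite S] (f : ℕ → S) :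
    ∃ s, ∃ᶠ n in atTop, f n = s := by
  by_contra! h
  obtain ⟨n, hn⟩ := (eventually_all.2 h).exists
  exact hn (f n) rfl

theorem exists_isLiYorkeTower [Finite A] (hp : IsConstantLength τ p) (hprim : IsPrimitive τ)
    (hinj : Function.Injective τ) (hinf : (subshift τ).Infinite) {r : (ℤ → A) × (ℤ → A)}
    (hr : r ∈ liYorkePairs τ) :
    ∃ ε q z, IsLiYorkeTower τ p ε q z ∧ r = (Prod.fst ∘ z 0, Prod.snd ∘ z 0) := by
  let Z := {z : ℤ → A × A // z ∈ pairSubshift τ ∧ IsLiYorke z}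
  have step (z : Z) :
      ∃ k < p, ∃ z' : Z, z.1 = (shift ^ (k : ℤ)) (inflate (pairSubst τ) p 1 z'.1) := by
    obtain ⟨k, hk, z', hz', hLY, h⟩ := exists_desubstitution hp hprim hinj hinf z.2.1 z.2.2
    exact ⟨k, hk, ⟨z', hz', hLY⟩, h⟩
  choose digit hdigit next hnext using step
  let z₀ : Z := ⟨fun t => (r.1 t, r.2 t), ⟨hr.1, hr.2.1⟩, isLiYorkePair_iff.1 hr.2.2⟩
  obtain ⟨q, hq⟩ := exists_frequently_eq fun n => (next^[n] z₀).1 0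
  refine ⟨fun n => digit (next^[n] z₀), q, fun n => (next^[n] z₀).1,
    ⟨⟨fun n => hdigit _, fun n => ?_⟩, fun n => (next^[n] z₀).2.2, hq⟩, rfl⟩
  rw [Function.iterate_succ_apply']
  exact hnext _

theorem coincidenceCondition_of_returns (hp : IsConstantLength τ p) {q : A × A}
    (hq : q ∉ Set.diagonal A) {m n i k f : ℕ} (hik : i < k) (hk : k < p ^ m)
    (hi : letter (pairSubst τ) m q i = q) (hdiag : letter (pairSubst τ) m q k ∈ Set.diagonal A)
    (hf : f < p ^ n) (hqf : letter (pairSubst τ) n q f = q) (hif : (i + 1) * p ^ n ≤ f * p ^ m) :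
    CoincidenceCondition τ := by
  have hpn := hp.pow_pos n
  have him := hik.trans hk
  have hleft : i * p ^ n + f < (i + 1) * p ^ n := by rw [add_one_mul]; omega
  refine coincidenceCondition_of_letter_eq hp hq (m := n + m) (i := i * p ^ n + f)
    (j := f * p ^ m + i) (k := k * p ^ n + 0) (by omega)
    (hleft.trans_le (Nat.mul_le_mul_right _ hik)) ?_ ?_ ?_ ?_ ?_
  · rw [pow_add]; exact mul_add_lt_mul hf him
  · rw [add_comm n, pow_add]; exact mul_add_lt_mul hk hpn
  · rw [letter_add hp.pairSubst him hf, hi, hqf]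
  · rw [add_comm n, letter_add hp.pairSubst hf him, hqf, hi]
  · rw [letter_add hp.pairSubst hk hpn]
    exact letter_pairSubst_mem_diagonal hp hdiag 0

namespace IsLiYorkeTower

variable {ε ε' : ℕ → ℕ} {q : A × A} {z z' : ℕ → ℤ → A × A}

theorem exists_coincidence (hz : IsLiYorkeTower τ p ε q z) (hp : IsConstantLength τ p)
    (hε : ∃ᶠ n in atTop, ε n ≠ p - 1) (n : ℕ) :
    q ∉ Set.diagonal A ∧ ∃ u > 0, ∃ R, ∀ r ≥ R, z (n + r) 0 = q →
      digitValue p ε n r + u < p ^ r ∧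
        letter (pairSubst τ) r q (digitValue p ε n r + u) ∈ Set.diagonal A := by
  have hp' := hp.pairSubst
  obtain ⟨t, ht⟩ := (hz.isLiYorke n).1.exists
  obtain ⟨u, hu, hdiag⟩ := frequently_atTop.1 ((hz.isLiYorke n).2 1) 1
  obtain ⟨R, hR⟩ := hz.exists_forall_add_lt hp' hε n (t + u)
  refine ⟨fun hq => ?_, u, hu, R, fun r hr hzr => ?_⟩
  · obtain ⟨N, hN, rfl⟩ := frequently_atTop.1 hz.frequently_eq (n + R)
    obtain ⟨r, rfl⟩ := Nat.exists_eq_add_of_le ((Nat.le_add_right _ _).trans hN)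
    have := hR r (by omega)
    rw [hz.apply_natCast hp' (r := r) (by omega)] at ht
    exact ht (letter_pairSubst_mem_diagonal hp hq _)
  · have hlt : digitValue p ε n r + u < p ^ r := by have := hR r hr; omega
    refine ⟨hlt, ?_⟩
    rw [← hzr, ← hz.apply_natCast hp' hlt]
    exact hdiag 0 one_pos

theorem coincidenceCondition_of_return (hz : IsLiYorkeTower τ p ε q z) (hp : IsConstantLength τ p)
    (hε : ∃ᶠ n in atTop, ε n ≠ p - 1) {n l j s e : ℕ} (hn : z n 0 = q) (hj : ε (n + l) < j)
    (hjp : j < p) (he : e < p ^ s)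
    (hret : letter (pairSubst τ) (s + 1) (z (n + (l + 1)) 0) (j * p ^ s + e) = q) :
    CoincidenceCondition τ := by
  have hp' := hp.pairSubst
  obtain ⟨hq, u, hu, R, hR⟩ := hz.exists_coincidence hp hε n
  obtain ⟨N, hN, hzN⟩ := frequently_atTop.1 hz.frequently_eq (n + (l + 1) + R)
  obtain ⟨g, rfl⟩ := Nat.exists_eq_add_of_le ((Nat.le_add_right _ _).trans hN)
  have hlevel : n + (l + 1) + g = n + (l + 1 + g) := add_assoc ..
  obtain ⟨hlt, hdiag⟩ := hR (l + 1 + g) (by omega) (hlevel ▸ hzN)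
  have horigin := hz.apply_zero hp' n (l + 1 + g)
  have hblock := hz.apply_zero hp' (n + (l + 1)) g
  rw [← hlevel, hzN, hn] at horigin
  rw [hzN] at hblock
  have hdigit : digitValue p ε n (l + 1 + g) =
      digitValue p ε n l + p ^ l * ε (n + l) + p ^ (l + 1) * digitValue p ε (n + (l + 1)) g := by
    rw [digitValue_add, digitValue_add, digitValue_one]
  set K := digitValue p ε (n + (l + 1)) g
  have hK : K < p ^ g := hz.digitValue_lt hp' _ g
  have hs : j * p ^ s + e < p ^ (s + 1) := by rw [pow_succ']; exact mul_add_lt_mul hjp he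
  refine coincidenceCondition_of_returns hp hq (Nat.lt_add_of_pos_right hu) hlt horigin.symm hdiag
    (n := s + 1 + g) (f := K * p ^ (s + 1) + (j * p ^ s + e)) ?_ ?_ ?_
  · rw [add_comm (s + 1) g, pow_add p g]; exact mul_add_lt_mul hK hs
  · rw [letter_add hp' hK hs, ← hblock, hret]
  · calc (digitValue p ε n (l + 1 + g) + 1) * p ^ (s + 1 + g)
        ≤ p ^ l * (ε (n + l) + 1 + p * K) * p ^ (s + 1 + g) := by
          gcongr
          have := hz.digitValue_lt hp' n l
          rw [hdigit]
          calc _ ≤ p ^ l + p ^ l * ε (n + l) + p ^ (l + 1) * K := by omega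
            _ = _ := by ring
      _ ≤ p ^ l * (j + p * K) * p ^ (s + 1 + g) := by gcongr; exact hj
      _ = (K * p ^ (s + 1) + j * p ^ s) * p ^ (l + 1 + g) := by ring
      _ ≤ (K * p ^ (s + 1) + (j * p ^ s + e)) * p ^ (l + 1 + g) := by gcongr; omega

theorem digit_le (hz : IsLiYorkeTower τ p ε q z) (hz' : IsTower (pairSubst τ) p ε' z')
    (hp : IsConstantLength τ p) (hcc : ¬ CoincidenceCondition τ)
    (hε : ∃ᶠ n in atTop, ε n ≠ p - 1) {m m' n : ℕ} (hm : z m 0 = q) (hm' : z' m' 0 = q)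
    (hmn : m ≤ n) (hmn' : m' ≤ n) (h : z (n + 1) 0 = z' (n + 1) 0) : ε' n ≤ ε n := by
  by_contra hlt
  obtain ⟨l, rfl⟩ := Nat.exists_eq_add_of_le hmn
  obtain ⟨s, hs⟩ := Nat.exists_eq_add_of_le hmn'
  refine hcc (hz.coincidenceCondition_of_return hp hε hm (not_le.1 hlt) (hz'.lt _)
    (hz'.digitValue_lt hp.pairSubst m' s) ?_)
  have hreturn := hz'.apply_zero hp.pairSubst m' (s + 1)
  rw [digitValue_add, digitValue_one, ← add_assoc, ← hs, ← h, hm',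
    add_comm (digitValue p ε' m' s), mul_comm (p ^ s), add_assoc m] at hreturn
  exact hreturn.symm

theorem digits_eventually_eq (hz : IsLiYorkeTower τ p ε q z) (hz' : IsLiYorkeTower τ p ε' q z')
    (hp : IsConstantLength τ p) (hcc : ¬ CoincidenceCondition τ)
    (hε : ∃ᶠ n in atTop, ε n ≠ p - 1) (hε' : ∃ᶠ n in atTop, ε' n ≠ p - 1)
    (hfreq : ∃ᶠ n in atTop, z n 0 = z' n 0) : ∀ᶠ n in atTop, ε n = ε' n := by
  obtain ⟨m, hm⟩ := hz.frequently_eq.exists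
  obtain ⟨m', hm'⟩ := hz'.frequently_eq.exists
  have digit_eq {n : ℕ} (hmn : m ≤ n) (hmn' : m' ≤ n) (h : z (n + 1) 0 = z' (n + 1) 0) :
      ε n = ε' n :=
    le_antisymm (hz'.digit_le hz.toIsTower hp hcc hε' hm' hm hmn' hmn h.symm)
      (hz.digit_le hz'.toIsTower hp hcc hε hm hm' hmn hmn' h)
  have apply_zero_eq : ∀ n ≥ max m m', z n 0 = z' n 0 := by
    intro n hn
    obtain ⟨N, hN, hzN⟩ := frequently_atTop.1 hfreq n
    induction N, hN using Nat.le_induction with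
    | base => exact hzN
    | succ k hk ih =>
      have hdigit := digit_eq (by omega) (by omega) hzN
      have hz1 := hz.apply_zero hp.pairSubst k 1
      have hz1' := hz'.apply_zero hp.pairSubst k 1
      rw [digitValue_one] at hz1 hz1'
      exact ih (by rw [hz1, hz1', hdigit, hzN])
  filter_upwards [eventually_ge_atTop (max m m')] with n hn
  exact digit_eq (by omega) (by omega) (apply_zero_eq _ (by omega))

end IsLiYorkeTower

theorem finite_range_of_frequently_eq {ι α S : Type*} [Finite S] (σ : ℕ → ι → S) (g : ι → α)
    (h : ∀ i j, (∃ᶠ n in atTop, σ n i = σ n j) → g i = g j) : (Set.range g).Finite := by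
  let U : Ultrafilter ℕ := hyperfilter ℕ
  have hU : (U : Filter ℕ) ≤ atTop := Nat.hyperfilter_le_atTop
  choose s hs using fun i => (U.map fun n => σ n i).eq_pure_of_finite
  have eventually_eq (i : ι) : ∀ᶠ n in U, σ n i = s i := by
    have : {s i} ∈ U.map fun n => σ n i := by rw [hs]; exact Set.mem_singleton (s i)
    exact this
  have hinjective : Function.Injective fun y => s (Set.rangeSplitting g y) := fun y y' hy => by
    refine Subtype.ext ?_
    rw [← Set.apply_rangeSplitting g y, ← Set.apply_rangeSplitting g y']
    refine h _ _ (Frequently.filter_mono (Eventually.frequently ?_) hU)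
    filter_upwards [eventually_eq (Set.rangeSplitting g y),
      eventually_eq (Set.rangeSplitting g y')] with n hn hn'
    exact hn.trans (hy.trans hn'.symm)
  have := Finite.of_injective _ hinjective
  exact Set.toFinite _

theorem pairOrbit_shift_zpow (e : ℤ) (r : (ℤ → A) × (ℤ → A)) :
    pairOrbit ((shift ^ e) r.1, (shift ^ e) r.2) = pairOrbit r := by
  ext s
  simp only [pairOrbit, Set.mem_ofPred_eq, shift_zpow_shift_zpow]
  exact ⟨fun ⟨n, hn⟩ => ⟨n + e, hn⟩, fun ⟨n, hn⟩ => ⟨n - e, by rwa [sub_add_cancel]⟩⟩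

theorem IsTower.pairOrbit_eq {ε : ℕ → ℕ} {z : ℕ → ℤ → A × A} (hz : IsTower (pairSubst τ) p ε z)
    (hp : IsConstantLength τ p) (n : ℕ) :
    pairOrbit (Prod.fst ∘ z 0, Prod.snd ∘ z 0) =
      pairOrbit (Prod.fst ∘ inflate (pairSubst τ) p n (z n),
        Prod.snd ∘ inflate (pairSubst τ) p n (z n)) := by
  rw [hz.eq_shift_inflate hp.pairSubst 0 n, comp_shift_zpow, comp_shift_zpow, zero_add]
  exact pairOrbit_shift_zpow _ (_, _)

theorem finite_orbits_of_not_coincidenceCondition [Finite A] (hp : IsConstantLength τ p)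
    (hprim : IsPrimitive τ) (hinj : Function.Injective τ) (hinf : (subshift τ).Infinite)
    (hcc : ¬ CoincidenceCondition τ) : (pairOrbit '' liYorkePairs τ).Finite := by
  choose ε q z hz hr using fun r : liYorkePairs τ => exists_isLiYorkeTower hp hprim hinj hinf r.2
  rw [Set.image_eq_range]
  refine finite_range_of_frequently_eq (fun n r => ((∃ᶠ k in atTop, ε r k ≠ p - 1), q r,
    z r n (-1), z r n 0, z r n 1)) _ fun r r' hfreq => ?_
  simp only [Prod.mk.injEq, frequently_and_distrib_left] at hfreq
  obtain ⟨hiff, hq, hwindow⟩ := hfreq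
  have hzr' := hz r'
  rw [← hq] at hzr'
  obtain ⟨n, hn⟩ : ∃ n, ∀ k ≥ n, ε r k = ε r' k := by
    refine eventually_atTop.1 ?_
    by_cases hε : ∃ᶠ k in atTop, ε r k ≠ p - 1
    · exact (hz r).digits_eventually_eq hzr' hp hcc hε (hiff.mp hε)
        (hwindow.mono fun _ h => h.2.1)
    · have hε' := hiff ▸ hε
      simp only [not_frequently, not_not] at hε hε'
      filter_upwards [hε, hε'] with k hk hk' using hk.trans hk'.symm
  have hpoint := (hz r).eq_of_frequently_eq (hz r').toIsTower hp.pairSubst hn hwindow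
  rw [hr r, hr r', (hz r).pairOrbit_eq hp n, (hz r').pairOrbit_eq hp n, hpoint]

theorem countable_of_countable_orbits {S : Set ((ℤ → A) × (ℤ → A))}
    (h : (pairOrbit '' S).Countable) : S.Countable := by
  have hunion : (⋃ O ∈ pairOrbit '' S, O).Countable := by
    refine h.biUnion ?_
    rintro _ ⟨r, -, rfl⟩
    refine (Set.countable_range fun n : ℤ => ((shift ^ n) r.1, (shift ^ n) r.2)).mono ?_
    rintro _ ⟨n, rfl⟩
    exact ⟨n, rfl⟩
  exact hunion.mono fun r hr =>
    Set.mem_biUnion (Set.mem_image_of_mem pairOrbit hr) (show r ∈ pairOrbit r from ⟨0, by simp⟩)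

end Substitution

theorem proposition3p8 {A : Type*} [Finite A] (τ : A → List A) (p : ℕ)
    (hlen : Substitution.IsConstantLength τ p)
    (hprim : Substitution.IsPrimitive τ)
    (hinj : Function.Injective τ)
    (hinf : (Substitution.subshift τ).Infinite) :
    ((Substitution.pairOrbit '' Substitution.liYorkePairs τ).Finite ∨
      ¬ (Substitution.pairOrbit '' Substitution.liYorkePairs τ).Countable) ∧
    (¬ (Substitution.liYorkePairs τ).Countable ↔ Substitution.CoincidenceCondition τ) := by
  by_cases h : Substitution.CoincidenceCondition τ
  · have huncountable := Substitution.not_countable_of_coincidenceCondition hlen hprim hinj hinf h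
    exact ⟨Or.inr (mt Substitution.countable_of_countable_orbits huncountable),
      iff_of_true huncountable h⟩
  · have hfinite := Substitution.finite_orbits_of_not_coincidenceCondition hlen hprim hinj hinf h
    have hcountable := Substitution.countable_of_countable_orbits hfinite.countable
    exact ⟨Or.inl hfinite, iff_of_false (not_not.2 hcountable) h⟩
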